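/- Conventions. Let $M$ be a monoid and $n\ge 0$. Then $M$ is of type left-$\mathrm{FP}_n$ (right-$\mathrm{FP}_n$) if there is an exact sequence $A_n\to A_{n-1}\to\cdots\to A_0\to\mathbb{Z}\to 0$ of left (right) $\mathbb{Z}M$-modules in which $A_0,\dots,A_n$ are finitely generated free and $\mathbb{Z}$ is the trivial module, on which every $m\in M$ acts as the identity. It is of type bi-$\mathrm{FP}_n$ if there is such an exact sequence of $(\mathbb{Z}M,\mathbb{Z}M)$-bimodules, where $A_0,\dots,A_n$ are free bimodules of finite rank (that is, finitely generated free left $\mathbb{Z}M\otimes_{\mathbb{Z}}(\mathbb{Z}M)^{\mathrm{op}}$-modules) and $M$ acts trivially on $\mathbb{Z}$ from both sides. A semigroup without a two-sided identity element has one of these properties if the monoid obtained from it by adjoining an identity element has it. For groups left- and right-$\mathrm{FP}_n$ are equivalent, and one says that the group is of type $\mathrm{FP}_n$. A semigroup is completely simple if it has no proper two-sided ideals and has minimal left ideals and minimal right ideals (all ideals are non-empty). The maximal subgroup of a semigroup $U$ containing an idempotent $e$ is the group of units of the monoid $eUe$. Theorem. Let $U$ be a completely simple semigroup, let $H$ be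 a maximal subgroup of $U$, and let $n\ge 1$. Then $U$ is of type left-$\mathrm{FP}_n$ and right-$\mathrm{FP}_n$ if and only if $U$ has finitely many left ideals and finitely many right ideals and the group $H$ is of type $\mathrm{FP}_n$. Equivalently, $U$ is of type bi-$\mathrm{FP}_n$ if and only if $U$ has finitely many left ideals and finitely many right ideals and $H$ is of type $\mathrm{FP}_n$; and also if and only if $U$ has finitely many left ideals and finitely many right ideals and all maximal subgroups of $U$ are of type $\mathrm{FP}_n$. -/

import Mathlib

open scoped TensorProduct

universe u v

namespace FPn

noncomputable section

/-! ### Partial free resolutions -/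

/-- A partial free resolution `A n → A (n-1) → ⋯ → A 0 → N → 0` of the left `R`-module `N`
by finitely generated free left `R`-modules.  The sequence is required to be exact at
`N, A 0, …, A (n-1)`, and nothing is required at `A n`.  The family `A` is indexed by `ℕ` only for
convenience: the modules and maps beyond `A n` are irrelevant padding (for example `0`). -/
structure PartialFreeResolution (R : Type u) [Ring R] (N : Type v) [AddCommGroup N] [Module R N]
    (n : ℕ) where
  A : ℕ → Type u
  [addCommGroup : ∀ i, AddCommGroup (A i)]
  [module : ∀ i, Module R (A i)]
  free : ∀ i, i ≤ n → Module.Free R (A i)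
  finite : ∀ i, i ≤ n → Module.Finite R (A i)
  d₀ : A 0 →ₗ[R] N
  d : ∀ i, A (i + 1) →ₗ[R] A i
  surjective : Function.Surjective d₀
  exact_zero : 0 < n → Function.Exact (d 0) d₀
  exact_succ : ∀ i, i + 1 < n → Function.Exact (d (i + 1)) (d i)

/-- Given a ring `R` with an augmentation `ε : R →+* ℤ`, regard `ℤ` as the trivial left `R`-module
`r • z = ε r * z`.  This says that the trivial module has a partial free resolution of length `n`
by finitely generated free left `R`-modules. -/
def TrivialModuleIsFP {R : Type u} [Ring R] (ε : R →+* ℤ) (n : ℕ) : Prop :=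
  letI : Module R ℤ := Module.compHom ℤ ε
  Nonempty (PartialFreeResolution R ℤ n)

/-! ### The properties left-, right- and bi-`FP_n` for monoids -/

/-- The standard augmentation `ℤM → ℤ`, `m ↦ 1`. -/
def augmentation (M : Type u) [Monoid M] : MonoidAlgebra ℤ M →ₐ[ℤ] ℤ :=
  MonoidAlgebra.lift ℤ ℤ M (1 : M →* ℤ)

theorem augmentation_single (M : Type u) [Monoid M] (m : M) (k : ℤ) :
    augmentation M (MonoidAlgebra.single m k) = k := by
  simp [augmentation]

/-- The augmentation on the opposite ring `(ℤM)ᵐᵒᵖ`, whose left modules are the right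
`ℤM`-modules. -/
def augmentationOp (M : Type u) [Monoid M] : (MonoidAlgebra ℤ M)ᵐᵒᵖ →ₐ[ℤ] ℤ :=
  (augmentation M).fromOpposite fun _ _ => Commute.all _ _

theorem augmentationOp_op_single (M : Type u) [Monoid M] (m : M) (k : ℤ) :
    augmentationOp M (MulOpposite.op (MonoidAlgebra.single m k)) = k :=
  augmentation_single M m k

/-- The augmentation on the enveloping ring `ℤM ⊗ (ℤM)ᵐᵒᵖ`, whose left modules are the
`(ℤM, ℤM)`-bimodules; both sides act trivially on `ℤ`. -/
def augmentationBi (M : Type u) [Monoid M] :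
    (MonoidAlgebra ℤ M ⊗[ℤ] (MonoidAlgebra ℤ M)ᵐᵒᵖ) →ₐ[ℤ] ℤ :=
  Algebra.TensorProduct.lift (augmentation M) (augmentationOp M) fun _ _ => Commute.all _ _

theorem augmentationBi_tmul (M : Type u) [Monoid M] (x : MonoidAlgebra ℤ M)
    (y : (MonoidAlgebra ℤ M)ᵐᵒᵖ) :
    augmentationBi M (x ⊗ₜ y) = augmentation M x * augmentationOp M y := by
  simp [augmentationBi]

/-- The monoid `M` is of type left-`FP_n`. -/
def MonoidIsLeftFP (n : ℕ) (M : Type u) [Monoid M] : Prop :=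
  TrivialModuleIsFP (augmentation M : MonoidAlgebra ℤ M →+* ℤ) n

/-- The monoid `M` is of type right-`FP_n`. -/
def MonoidIsRightFP (n : ℕ) (M : Type u) [Monoid M] : Prop :=
  TrivialModuleIsFP (augmentationOp M : (MonoidAlgebra ℤ M)ᵐᵒᵖ →+* ℤ) n

/-- The monoid `M` is of type bi-`FP_n`: there is a length `n` resolution of `ℤ` by free
`(ℤM, ℤM)`-bimodules of finite rank. -/
def MonoidIsBiFP (n : ℕ) (M : Type u) [Monoid M] : Prop :=
  TrivialModuleIsFP (augmentationBi M : MonoidAlgebra ℤ M ⊗[ℤ] (MonoidAlgebra ℤ M)ᵐᵒᵖ →+* ℤ) n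

/-- A group is of type `FP_n` if it is of type left-`FP_n`. -/
def GroupIsFP (n : ℕ) (G : Type u) [Group G] : Prop :=
  MonoidIsLeftFP n G

/-! ### Extension to semigroups -/

/-- `e` is a two-sided identity element of the semigroup `S`. -/
def IsIdentity {S : Type u} [Semigroup S] (e : S) : Prop :=
  ∀ x : S, e * x = x ∧ x * e = x

/-- A semigroup with a two-sided identity element, as a monoid. -/
abbrev monoidOfIdentity {S : Type u} [Semigroup S] (e : S) (he : IsIdentity e) : Monoid S where
  one := e
  one_mul x := (he x).1
  mul_one x := (he x).2

open Classical in
/-- Extends a property of monoids to semigroups: a semigroup `S` with a two-sided identity element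
has the property if it has it as a monoid, and a semigroup `S` without a two-sided identity element
has it if the monoid `S¹ = WithOne S` obtained by adjoining an identity element does. -/
def ExtendToSemigroup (P : ∀ (M : Type u) [Monoid M], Prop) (S : Type u) [Semigroup S] : Prop :=
  if h : ∃ e : S, IsIdentity e then @P S (monoidOfIdentity h.choose h.choose_spec)
  else P (WithOne S)

/-- The semigroup `S` is of type left-`FP_n`. -/
def IsLeftFP (n : ℕ) (S : Type u) [Semigroup S] : Prop :=
  ExtendToSemigroup (fun M _ => MonoidIsLeftFP n M) S

/-- The semigroup `S` is of type right-`FP_n`. -/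
def IsRightFP (n : ℕ) (S : Type u) [Semigroup S] : Prop :=
  ExtendToSemigroup (fun M _ => MonoidIsRightFP n M) S

/-- The semigroup `S` is of type bi-`FP_n`. -/
def IsBiFP (n : ℕ) (S : Type u) [Semigroup S] : Prop :=
  ExtendToSemigroup (fun M _ => MonoidIsBiFP n M) S

/-! ### Ideals, completely simple semigroups and maximal subgroups -/

section Semigroup

variable {S : Type u} [Semigroup S]

/-- A left ideal of a semigroup: a nonempty subset `A` with `S A ⊆ A`. -/
def IsLeftIdeal (A : Set S) : Prop :=
  A.Nonempty ∧ ∀ s : S, ∀ a ∈ A, s * a ∈ A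

/-- A right ideal of a semigroup: a nonempty subset `A` with `A S ⊆ A`. -/
def IsRightIdeal (A : Set S) : Prop :=
  A.Nonempty ∧ ∀ s : S, ∀ a ∈ A, a * s ∈ A

end Semigroup

/-- A semigroup is completely simple if it has no proper two-sided ideals, and has minimal left and
right ideals. -/
structure IsCompletelySimple (S : Type u) [Semigroup S] : Prop where
  simple : ∀ A : Set S, IsLeftIdeal A → IsRightIdeal A → A = Set.univ
  exists_minimal_left : ∃ A : Set S, Minimal IsLeftIdeal A
  exists_minimal_right : ∃ A : Set S, Minimal IsRightIdeal A

/-- The semigroup `S` has finitely many left ideals and finitely many right ideals. -/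
def HasFinitelyManyLeftAndRightIdeals (S : Type u) [Semigroup S] : Prop :=
  {A : Set S | IsLeftIdeal A}.Finite ∧ {A : Set S | IsRightIdeal A}.Finite

/-- For an idempotent `e`, the local submonoid `eSe`, with identity element `e`. -/
abbrev cornerMonoid {S : Type u} [Semigroup S] {e : S} (he : IsIdempotentElem e) :
    Monoid (Subsemigroup.corner e) where
  one := ⟨e, e, by simp only [he.eq]⟩
  one_mul r := Subtype.ext ((Subsemigroup.mem_corner_iff he).mp r.2).1
  mul_one r := Subtype.ext ((Subsemigroup.mem_corner_iff he).mp r.2).2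

/-- The maximal subgroup of `S` containing the idempotent `e`: the group of units of `eSe`. -/
def MaximalSubgroup {S : Type u} [Semigroup S] {e : S} (he : IsIdempotentElem e) : Type u :=
  @Units (Subsemigroup.corner e) (cornerMonoid he)

instance {S : Type u} [Semigroup S] {e : S} (he : IsIdempotentElem e) :
    Group (MaximalSubgroup he) :=
  @Units.instGroup (Subsemigroup.corner e) (cornerMonoid he)

end

end FPn

/-!
The proof reduces every finiteness property to a recursive notion of module of type `FP_n`
(`FPn.FP`), which behaves well in short exact sequences (`FP.extension`, `FP.quotient`,
`FP.kernel`), under exact functors that map the regular module to a module of type `FP_n`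
(`IsExactFunctor.fp`), and under retracts (`FP.of_retract`).

*Bimodules.*  The enveloping ring of `ℤM` is `ℤ[M × Mᵐᵒᵖ]`.  Both factors of a product of monoids
are retracts of it.  Conversely, if the trivial module is of type `FP_n` over `ℤM` and over `ℤN`,
then `ℤN = ℤ[M × N] ⊗_{ℤM} ℤ` is of type `FP_n` over `ℤ[M × N]`, and restriction of scalars along
`ℤ[M × N] → ℤN` shows that so is `ℤ`.  Hence bi-`FP_n` is the conjunction of left- and
right-`FP_n` (`monoidIsBiFP_iff`), and as right modules over `M` are left modules over `Mᵐᵒᵖ`,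
it suffices to study left modules.  If `U` has an identity, it is a group isomorphic to its maximal
subgroup, and nothing else is needed; below, `U¹` is `U` with a new identity adjoined.

*Sufficiency.*  Let `e` be an idempotent of the completely simple semigroup `U`, let `G` be the
maximal subgroup of `e`, and let `I` and `L` be the sets of minimal right and minimal left ideals,
both finite.  The left ideal `Ue` is a free right `G`-set with orbit set `I`, and `ℤ[Ue]` is a
direct summand of `ℤU¹`.  So tensoring with `ℤ[Ue]` over `ℤG` turns the `FP_n` module `ℤ` into the
`ℤU¹`-module `ℤI` of type `FP_n`.  The kernel of `ℤI → ℤ` is killed by `U`, so it is a finite sum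
of copies of `ℤU¹ / ℤU`; here `ℤU` is projective, and finitely generated because `L` is finite
(`fp_triv_killU`).  It follows that `ℤ` is of type `FP_n` over `ℤU¹` (`MonoidIsLeftFP.withOne`).
The functor `ℤ[Ue] ⊗_{ℤG} -` is realized concretely, by means of a cocycle of the action of `U¹` on
`I` with values in `G` (`Cocycle.Ind`); the base change of the preceding paragraph is another
instance of the same construction.

*Necessity.*  If the augmentation ideal of `ℤU¹` is finitely generated, then `I` is finite
(`finite_principalRight_of_leftFP`), and the opposite statement bounds `L`.  When `L` is finite, the
exact functor `N ↦ eN` maps `ℤU¹` to a finitely generated free `ℤG`-module and `ℤ` to `ℤ`, so that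
type `FP_n` passes from `U¹` to `G` (`MonoidIsLeftFP.of_withOne`).
-/

namespace FPn

noncomputable section

open Function

/-! ### Modules of type `FP_n` -/

section FP

variable {R : Type u} [Ring R]

/-- The module `N` is of type `FP_n`, defined by recursion on `n`: type `FP_0` means finitely
generated, and type `FP_{n+1}` means that some surjection `R^m → N` has a kernel of type `FP_n`. -/
def FP (R : Type u) [Ring R] : ℕ → ∀ (N : Type u) [AddCommGroup N] [Module R N], Prop
  | 0, N, _, _ => Module.Finite R N
  | n + 1, N, _, _ => ∃ (m : ℕ) (f : (Fin m → R) →ₗ[R] N),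
      Surjective f ∧ FP R n (LinearMap.ker f)

variable {A B C : Type u} [AddCommGroup A] [Module R A] [AddCommGroup B] [Module R B]
  [AddCommGroup C] [Module R C]

theorem FP.finite {n : ℕ} (h : FP R n A) : Module.Finite R A := by
  cases n with
  | zero => exact h
  | succ n =>
    obtain ⟨m, f, hf, -⟩ := h
    exact Module.Finite.of_surjective f hf

theorem FP.equiv {n : ℕ} (e : A ≃ₗ[R] B) (h : FP R n A) : FP R n B := by
  cases n with
  | zero =>
    have : Module.Finite R A := h
    exact Module.Finite.equiv e
  | succ n =>
    obtain ⟨m, f, hf, hk⟩ := h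
    refine ⟨m, e.toLinearMap ∘ₗ f, e.surjective.comp hf, ?_⟩
    rw [LinearEquiv.ker_comp]
    exact hk

theorem FP.pred {n : ℕ} (h : FP R (n + 1) A) : FP R n A := by
  induction n generalizing A with
  | zero => exact h.finite
  | succ n ih =>
    obtain ⟨m, f, hf, hk⟩ := h
    exact ⟨m, f, hf, ih hk⟩

theorem FP.mono {m n : ℕ} (hmn : m ≤ n) (h : FP R n A) : FP R m A := by
  induction n, hmn using Nat.le_induction with
  | base => exact h
  | succ n _ ih => exact ih h.pred

/-- An extension of modules of type `FP_n` is of type `FP_n`; this is the horseshoe lemma. -/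
theorem FP.extension {n : ℕ} {f : A →ₗ[R] B} {g : B →ₗ[R] C} (hf : Injective f)
    (hfg : Exact f g) (hg : Surjective g) (hA : FP R n A) (hC : FP R n C) : FP R n B := by
  induction n generalizing A B C with
  | zero =>
    have : Module.Finite R A := hA
    have : Module.Finite R C := hC
    exact Module.Finite.of_exact hfg hg
  | succ n ih =>
    obtain ⟨a, p, hp, hpk⟩ := hA
    obtain ⟨c, q, hq, hqk⟩ := hC
    obtain ⟨s, hs⟩ := Module.projective_lifting_property g q hg
    have hs' : ∀ x, g (s x) = q x := fun x => LinearMap.congr_fun hs x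
    have hgf : ∀ x, g (f x) = 0 := fun x => (hfg _).2 ⟨x, rfl⟩
    let e := LinearEquiv.sumArrowLequivProdArrow (Fin a) (Fin c) R R
    let e' : (Fin (a + c) → R) ≃ₗ[R] (Fin a → R) × (Fin c → R) :=
      (LinearEquiv.funCongrLeft R R finSumFinEquiv).trans e
    let r₀ : (Fin a → R) × (Fin c → R) →ₗ[R] B := (f ∘ₗ p).coprod s
    have hr₀ : ∀ x, r₀ x = f (p x.1) + s x.2 := fun x => rfl
    have hr₀s : Surjective r₀ := by
      intro b
      obtain ⟨y, hy⟩ := hq (g b)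
      obtain ⟨z, hz⟩ := (hfg (b - s y)).1 (by rw [map_sub, hs', hy, sub_self])
      obtain ⟨x, rfl⟩ := hp z
      exact ⟨(x, y), by rw [hr₀, hz]; abel⟩
    have key : FP R n (LinearMap.ker r₀) := by
      have h1 : ∀ x : LinearMap.ker p,
          LinearMap.inl R (Fin a → R) (Fin c → R) x.1 ∈ LinearMap.ker r₀ := by
        rintro ⟨x, hx⟩
        change f (p x) + s 0 = 0
        simp [show p x = 0 from hx]
      have h2 : ∀ x : LinearMap.ker r₀, LinearMap.snd R (Fin a → R) (Fin c → R) x.1 ∈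
          LinearMap.ker q := by
        rintro ⟨x, hx⟩
        have := congrArg g (show f (p x.1) + s x.2 = 0 from hx)
        rw [map_add, hgf, hs', zero_add, map_zero] at this
        exact this
      refine ih
        (f := ((LinearMap.inl R (Fin a → R) (Fin c → R)).comp
          (LinearMap.ker p).subtype).codRestrict _ h1)
        (g := ((LinearMap.snd R (Fin a → R) (Fin c → R)).comp
          (LinearMap.ker r₀).subtype).codRestrict _ h2) ?_ ?_ ?_ hpk hqk
      · intro x y hxy
        have := congrArg (fun z => (z.1 : (Fin a → R) × (Fin c → R)).1) hxy
        exact Subtype.ext this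
      · rintro ⟨⟨x, y⟩, hxy⟩
        constructor
        · intro h
          have hy : y = 0 := congrArg Subtype.val h
          subst hy
          refine ⟨⟨x, hf ?_⟩, rfl⟩
          have : f (p x) + s 0 = 0 := hxy
          simpa using this
        · rintro ⟨z, hz⟩
          have := congrArg (fun z => (z.1 : (Fin a → R) × (Fin c → R)).2) hz
          exact Subtype.ext this.symm
      · rintro ⟨y, hy⟩
        obtain ⟨z, hz⟩ := (hfg (s y)).1 (by rw [hs']; exact hy)
        obtain ⟨x, hx⟩ := hp (-z)
        refine ⟨⟨(x, y), ?_⟩, rfl⟩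
        change f (p x) + s y = 0
        rw [← hz, hx, map_neg, neg_add_cancel]
    refine ⟨a + c, r₀ ∘ₗ e'.toLinearMap, hr₀s.comp e'.surjective, ?_⟩
    refine FP.equiv ?_ key
    exact (LinearEquiv.ofSubmodule' e' (LinearMap.ker r₀)).symm

/-- A quotient of a module of type `FP_{n+1}` by a submodule of type `FP_n` is of type
`FP_{n+1}`. -/
theorem FP.quotient {n : ℕ} {f : A →ₗ[R] B} {g : B →ₗ[R] C} (hf : Injective f)
    (hfg : Exact f g) (hg : Surjective g) (hA : FP R n A) (hB : FP R (n + 1) B) :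
    FP R (n + 1) C := by
  obtain ⟨m, p, hp, hpk⟩ := hB
  refine ⟨m, g ∘ₗ p, hg.comp hp, ?_⟩
  have h2 : ∀ x : LinearMap.ker (g ∘ₗ p), ∃ a, f a = p x := fun x => (hfg _).1 x.2
  let e := LinearEquiv.ofInjective f hf
  have h3 : ∀ x : LinearMap.ker (g ∘ₗ p), p x ∈ LinearMap.range f := fun x => h2 x
  let t : LinearMap.ker (g ∘ₗ p) →ₗ[R] A := e.symm.toLinearMap ∘ₗ
    ((p ∘ₗ (LinearMap.ker (g ∘ₗ p)).subtype).codRestrict _ h3)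
  have ht : ∀ x, f (t x) = p x := fun x =>
    congrArg Subtype.val (e.apply_symm_apply ⟨p x, h3 x⟩)
  have hle : LinearMap.ker p ≤ LinearMap.ker (g ∘ₗ p) := by
    intro x hx
    rw [LinearMap.mem_ker] at hx ⊢
    simp [hx]
  refine FP.extension (f := Submodule.inclusion hle) (g := t)
    (Submodule.inclusion_injective hle) ?_ ?_ hpk hA
  · intro x
    constructor
    · intro hx
      exact ⟨⟨x.1, by rw [LinearMap.mem_ker, ← ht, hx, map_zero]⟩, rfl⟩
    · rintro ⟨y, rfl⟩
      apply hf
      rw [ht, map_zero]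
      exact y.2
  · intro a
    obtain ⟨x, hx⟩ := hp (f a)
    have hxk : x ∈ LinearMap.ker (g ∘ₗ p) := by
      rw [LinearMap.mem_ker, LinearMap.comp_apply, hx]
      exact (hfg _).2 ⟨a, rfl⟩
    exact ⟨⟨x, hxk⟩, hf (by rw [ht]; exact hx)⟩

theorem FP.free (n m : ℕ) : FP R n (Fin m → R) := by
  induction n generalizing m with
  | zero => exact (inferInstance : Module.Finite R (Fin m → R))
  | succ n ih =>
    refine ⟨m, LinearMap.id, surjective_id, ?_⟩
    refine FP.equiv (A := Fin 0 → R) ?_ (ih 0)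
    rw [LinearMap.ker_id]
    exact 0

theorem FP.of_projective (n : ℕ) [Module.Finite R A] [Module.Projective R A] : FP R n A := by
  induction n generalizing A with
  | zero => exact ‹Module.Finite R A›
  | succ n ih =>
    obtain ⟨m, f, hf⟩ := Module.Finite.exists_fin' R A
    obtain ⟨s, hs⟩ := Module.projective_lifting_property f LinearMap.id hf
    -- The kernel is a retract of `R^m` by `x ↦ x - s (f x)`.
    let r : (Fin m → R) →ₗ[R] LinearMap.ker f :=
      (LinearMap.id - s ∘ₗ f).codRestrict _ fun x => by
        have := LinearMap.congr_fun hs (f x)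
        simp only [LinearMap.comp_apply, LinearMap.id_apply] at this
        simp [this]
    have hr : r ∘ₗ (LinearMap.ker f).subtype = LinearMap.id := by
      ext1 x
      apply Subtype.ext
      have : f x.1 = 0 := x.2
      simp [r, this]
    have : Module.Projective R (LinearMap.ker f) :=
      Module.Projective.of_split _ r hr
    have : Module.Finite R (LinearMap.ker f) :=
      Module.Finite.of_surjective r fun x => ⟨x, LinearMap.congr_fun hr x⟩
    exact ⟨m, f, hf, ih⟩

/-- In a short exact sequence with middle term of type `FP_n` and quotient of type `FP_{n+1}`, the
kernel is of type `FP_n`.  The proof forms the pullback of a presentation of the quotient. -/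
theorem FP.kernel {n : ℕ} {f : A →ₗ[R] B} {g : B →ₗ[R] C} (hf : Injective f)
    (hfg : Exact f g) (hg : Surjective g) (hB : FP R n B) (hC : FP R (n + 1) C) :
    FP R n A := by
  obtain ⟨m, p, hp, hpk⟩ := hC
  have hgf : ∀ x, g (f x) = 0 := fun x => (hfg _).2 ⟨x, rfl⟩
  obtain ⟨s, hs⟩ := Module.projective_lifting_property g p hg
  have hs' : ∀ x, g (s x) = p x := fun x => LinearMap.congr_fun hs x
  -- The pullback is `A × R^m`, mapped onto `B` by `f + s` with kernel isomorphic to `ker p`.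
  have hP : FP R n (A × (Fin m → R)) := by
    let r : A × (Fin m → R) →ₗ[R] B := f.coprod s
    have hr : ∀ x, r x = f x.1 + s x.2 := fun x => rfl
    have hker : ∀ x : LinearMap.ker p, -(s x.1) ∈ LinearMap.range f := by
      rintro ⟨x, hx⟩
      refine (hfg _).1 ?_
      rw [map_neg, hs', hx, neg_zero]
    let e := LinearEquiv.ofInjective f hf
    let t : LinearMap.ker p →ₗ[R] A := e.symm.toLinearMap ∘ₗ
      ((-(s ∘ₗ (LinearMap.ker p).subtype)).codRestrict _ hker)
    have ht : ∀ x, f (t x) = -(s x.1) := fun x =>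
      congrArg Subtype.val (e.apply_symm_apply ⟨_, hker x⟩)
    refine FP.extension (f := t.prod (LinearMap.ker p).subtype) (g := r) ?_ ?_ ?_ hpk hB
    · intro x y hxy
      exact Subtype.ext (congrArg Prod.snd hxy)
    · rintro ⟨a, x⟩
      constructor
      · intro h
        have hx : p x = 0 := by
          have := congrArg g h
          rwa [hr, map_add, hgf, hs', zero_add, map_zero] at this
        refine ⟨⟨x, hx⟩, Prod.ext (hf ?_) rfl⟩
        change f (t _) = f a
        rw [ht]
        exact (eq_neg_of_add_eq_zero_left h).symm
      · rintro ⟨y, hy⟩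
        rw [← hy, hr]
        change f (t y) + s y.1 = 0
        rw [ht, neg_add_cancel]
    · intro b
      obtain ⟨y, hy⟩ := hp (g b)
      obtain ⟨z, hz⟩ := (hfg (b - s y)).1 (by rw [map_sub, hs', hy, sub_self])
      exact ⟨(z, y), by rw [hr, hz]; abel⟩
  cases n with
  | zero =>
    have : Module.Finite R (A × (Fin m → R)) := hP
    exact Module.Finite.of_surjective (LinearMap.fst R A (Fin m → R)) fun a => ⟨(a, 0), rfl⟩
  | succ n =>
    refine FP.quotient (f := LinearMap.inr R A (Fin m → R))
      (g := LinearMap.fst R A (Fin m → R)) LinearMap.inr_injective ?_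
      (fun a => ⟨(a, 0), rfl⟩) (FP.free n m) hP
    exact Exact.inr_fst

/-- A module that has a surjection with kernel of type `FP_n` from a finitely generated projective
module is of type `FP_{n+1}`. -/
theorem FP.of_surjective {n : ℕ} [Module.Finite R B] [Module.Projective R B] (g : B →ₗ[R] C)
    (hg : Surjective g) (hk : FP R n (LinearMap.ker g)) : FP R (n + 1) C :=
  FP.quotient (f := (LinearMap.ker g).subtype) (Submodule.subtype_injective _)
    (LinearMap.exact_subtype_ker_map g) hg hk (FP.of_projective _)

theorem FP.ker_of_surjective {n : ℕ} [Module.Finite R B] [Module.Projective R B] (g : B →ₗ[R] C)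
    (hg : Surjective g) (hC : FP R (n + 1) C) : FP R n (LinearMap.ker g) :=
  FP.kernel (f := (LinearMap.ker g).subtype) (Submodule.subtype_injective _)
    (LinearMap.exact_subtype_ker_map g) hg (FP.of_projective _) hC

theorem exact_single_funLeft (R A : Type u) [Ring R] [AddCommGroup A] [Module R A] (m : ℕ) :
    Exact (LinearMap.single R (fun _ : Fin (m + 1) => A) 0) (LinearMap.funLeft R A Fin.succ) := by
  intro x
  constructor
  · intro hx
    refine ⟨x 0, ?_⟩
    ext j
    refine Fin.cases (by simp) (fun j => ?_) j
    have := congrFun hx j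
    simpa [LinearMap.funLeft_apply] using this.symm
  · rintro ⟨y, rfl⟩
    ext j
    simp [LinearMap.funLeft_apply]

theorem FP.pi {n : ℕ} (hA : FP R n A) (m : ℕ) : FP R n (Fin m → A) := by
  induction m with
  | zero => exact FP.of_projective n
  | succ m ih =>
    exact FP.extension (Pi.single_injective (M := fun _ => A) 0) (exact_single_funLeft R A m)
      (LinearMap.funLeft_surjective_of_injective R A _ (Fin.succ_injective m)) hA ih

end FP

/-! ### Change of rings -/

section ChangeOfRings

variable {R S : Type u} [Ring R] [Ring S]

/-- Type `FP_n` passes to retracts: if `S` is a retract of the ring `R`, and the `S`-module `N` is a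
compatible retract of the `R`-module `N'`, then `N` inherits type `FP_n` from `N'`.  The point is
that presentations of `N'` and `N` can be chosen so that the latter is a retract of the former;
then the kernels satisfy the same hypotheses. -/
theorem FP.of_retract {n : ℕ} {i : S →+* R} {r : R →+* S} (hri : ∀ s, r (i s) = s)
    {N N' : Type u} [AddCommGroup N] [Module S N] [AddCommGroup N'] [Module R N']
    (a : N →ₛₗ[i] N') (b : N' →ₛₗ[r] N) (hba : ∀ x, b (a x) = x) (h : FP R n N') :
    FP S n N := by
  have : RingHomSurjective r := ⟨fun s => ⟨i s, hri s⟩⟩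
  induction n generalizing N N' with
  | zero =>
    have : Module.Finite R N' := h
    exact Module.Finite.of_surjective b fun x => ⟨a x, hba x⟩
  | succ n ih =>
    have : Module.Finite R N' := h.finite
    obtain ⟨m, f, hf⟩ := Module.Finite.exists_fin' R N'
    -- The generators `x j` of `N'`, followed by the elements `a (b (x j))`.
    let x : Fin m → N' := fun j => f fun k => if j = k then 1 else 0
    have hfx : ∀ v, f v = ∑ j, v j • x j := f.pi_apply_eq_sum_univ
    let F' : (Fin m ⊕ Fin m → R) →ₗ[R] N' :=
      Fintype.linearCombination R (Sum.elim x fun j => a (b (x j)))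
    let F : (Fin m → S) →ₗ[S] N := Fintype.linearCombination S fun j => b (x j)
    have hF' : ∀ v, F' v = ∑ j, v (.inl j) • x j + ∑ j, v (.inr j) • a (b (x j)) := fun v => by
      simp [F', Fintype.linearCombination_apply]
    have hF : ∀ v, F v = ∑ j, v j • b (x j) := fun v => by
      simp [F, Fintype.linearCombination_apply]
    have hF's : Surjective F' := fun y => by
      obtain ⟨v, rfl⟩ := hf y
      exact ⟨Sum.elim v 0, by simp [hF', hfx]⟩
    have hFs : Surjective F := fun y => by
      obtain ⟨v, hv⟩ := hf (a y)
      refine ⟨fun j => r (v j), ?_⟩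
      rw [hF, ← hba y, ← hv, hfx, map_sum]
      exact Finset.sum_congr rfl fun j _ => (map_smulₛₗ b _ _).symm
    let a₁ : (Fin m → S) →ₛₗ[i] (Fin m ⊕ Fin m → R) :=
      { toFun := fun v => Sum.elim 0 fun j => i (v j)
        map_add' := fun v w => by ext j; cases j <;> simp
        map_smul' := fun s v => by ext j; cases j <;> simp }
    let b₁ : (Fin m ⊕ Fin m → R) →ₛₗ[r] (Fin m → S) :=
      { toFun := fun v j => r (v (.inl j)) + r (v (.inr j))
        map_add' := fun v w => by ext j; simp; abel
        map_smul' := fun s v => by ext j; simp [mul_add] }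
    have ha₁ : ∀ v, F' (a₁ v) = a (F v) := fun v => by
      rw [hF, hF', map_sum]
      simp [a₁, map_smulₛₗ]
    have hb₁ : ∀ v, F (b₁ v) = b (F' v) := fun v => by
      rw [hF, hF', map_add, map_sum, map_sum, ← Finset.sum_add_distrib]
      simp [b₁, map_smulₛₗ, hba, add_smul]
    refine FP.of_surjective F hFs (ih (N' := LinearMap.ker F')
      ⟨⟨fun v => ⟨a₁ v.1, ?_⟩, fun v w => ?_⟩, fun s v => ?_⟩
      ⟨⟨fun v => ⟨b₁ v.1, ?_⟩, fun v w => ?_⟩, fun s v => ?_⟩ ?_ (h.ker_of_surjective F' hF's))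
    · rw [LinearMap.mem_ker, ha₁, LinearMap.mem_ker.1 v.2, map_zero]
    · exact Subtype.ext (map_add a₁ v.1 w.1)
    · exact Subtype.ext (map_smulₛₗ a₁ s v.1)
    · rw [LinearMap.mem_ker, hb₁, LinearMap.mem_ker.1 v.2, map_zero]
    · exact Subtype.ext (map_add b₁ v.1 w.1)
    · exact Subtype.ext (map_smulₛₗ b₁ s v.1)
    · rintro ⟨v, hv⟩
      apply Subtype.ext
      funext j
      simp [a₁, b₁, hri]

open CategoryTheory

/-- A functor between module categories is exact if it preserves short exact sequences.  No
additivity is assumed. -/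
structure IsExactFunctor (F : ModuleCat.{u} R ⥤ ModuleCat.{u} S) : Prop where
  map_shortExact : ∀ {A B C : Type u} [AddCommGroup A] [Module R A] [AddCommGroup B] [Module R B]
    [AddCommGroup C] [Module R C] (f : A →ₗ[R] B) (g : B →ₗ[R] C),
    Injective f → Exact f g → Surjective g →
      Injective (F.map (ModuleCat.ofHom f)).hom ∧
      Exact (F.map (ModuleCat.ofHom f)).hom (F.map (ModuleCat.ofHom g)).hom ∧
      Surjective (F.map (ModuleCat.ofHom g)).hom

theorem IsExactFunctor.fp_free {F : ModuleCat.{u} R ⥤ ModuleCat.{u} S} (hF : IsExactFunctor F)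
    {n : ℕ} (h : FP S n (F.obj (ModuleCat.of R R))) (m : ℕ) :
    FP S n (F.obj (ModuleCat.of R (Fin m → R))) := by
  induction m with
  | zero =>
    -- Exactness of `F` on `0 → 0 → 0 → 0 → 0` shows that `F 0 = 0`.
    obtain ⟨-, h2, -⟩ := hF.map_shortExact (A := Fin 0 → R) (B := Fin 0 → R) (C := Fin 0 → R)
      LinearMap.id LinearMap.id injective_id (fun x => ⟨fun _ => ⟨x, rfl⟩, fun _ =>
        Subsingleton.elim _ _⟩) surjective_id
    have h0 : ∀ x : F.obj (ModuleCat.of R (Fin 0 → R)), x = 0 := fun x => by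
      rw [ModuleCat.ofHom_id, F.map_id] at h2
      exact (h2 x).2 ⟨x, rfl⟩
    have : Subsingleton (F.obj (ModuleCat.of R (Fin 0 → R))) :=
      ⟨fun x y => by rw [h0 x, h0 y]⟩
    exact FP.of_projective n
  | succ m ih =>
    obtain ⟨h1, h2, h3⟩ := hF.map_shortExact (LinearMap.single R (fun _ : Fin (m + 1) => R) 0)
      (LinearMap.funLeft R R Fin.succ) (Pi.single_injective (M := fun _ => R) 0)
      (exact_single_funLeft R R m)
      (LinearMap.funLeft_surjective_of_injective R R _ (Fin.succ_injective m))
    exact FP.extension h1 h2 h3 h ih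

/-- An exact functor that sends the regular module to a module of type `FP_n` preserves
type `FP_n`. -/
theorem IsExactFunctor.fp {F : ModuleCat.{u} R ⥤ ModuleCat.{u} S} (hF : IsExactFunctor F)
    {n : ℕ} (h : FP S n (F.obj (ModuleCat.of R R))) {A : Type u} [AddCommGroup A] [Module R A]
    (hA : FP R n A) : FP S n (F.obj (ModuleCat.of R A)) := by
  induction n generalizing A with
  | zero =>
    have : Module.Finite R A := hA
    obtain ⟨m, f, hf⟩ := Module.Finite.exists_fin' R A
    obtain ⟨-, -, h3⟩ := hF.map_shortExact (LinearMap.ker f).subtype f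
      (Submodule.subtype_injective _) (LinearMap.exact_subtype_ker_map f) hf
    have : Module.Finite S (F.obj (ModuleCat.of R (Fin m → R))) := hF.fp_free h m
    exact Module.Finite.of_surjective _ h3
  | succ n ih =>
    obtain ⟨m, f, hf, hk⟩ := hA
    obtain ⟨h1, h2, h3⟩ := hF.map_shortExact (LinearMap.ker f).subtype f
      (Submodule.subtype_injective _) (LinearMap.exact_subtype_ker_map f) hf
    exact FP.quotient h1 h2 h3 (ih h.pred hk) (hF.fp_free h m)

theorem isExactFunctor_restrictScalars (φ : S →+* R) :
    IsExactFunctor (ModuleCat.restrictScalars.{u} φ) :=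
  ⟨fun _ _ h1 h2 h3 => ⟨h1, h2, h3⟩⟩

/-- If `R` is of type `FP_n` over `S`, then so is every `R`-module of type `FP_n`. -/
theorem FP.restrictScalars (φ : S →+* R) {n : ℕ}
    (h : FP S n ((ModuleCat.restrictScalars φ).obj (ModuleCat.of R R)))
    {A : Type u} [AddCommGroup A] [Module R A] (hA : FP R n A) :
    FP S n ((ModuleCat.restrictScalars φ).obj (ModuleCat.of R A)) :=
  (isExactFunctor_restrictScalars φ).fp h hA

end ChangeOfRings

/-! ### Comparison with partial free resolutions -/

section Resolution

variable {R : Type u} [Ring R]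

theorem FP.of_resolution {n : ℕ} {N : Type u} [AddCommGroup N] [Module R N]
    (P : PartialFreeResolution R N n) : FP R n N := by
  induction n generalizing N with
  | zero =>
    let := P.addCommGroup
    let := P.module
    have := P.finite 0 le_rfl
    exact Module.Finite.of_surjective P.d₀ P.surjective
  | succ n ih =>
    let := P.addCommGroup
    let := P.module
    have := P.finite 0 (Nat.zero_le _)
    have := P.free 0 (Nat.zero_le _)
    have hd : ∀ x, P.d 0 x ∈ LinearMap.ker P.d₀ := fun x =>
      (P.exact_zero (Nat.succ_pos n) _).2 ⟨x, rfl⟩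
    refine FP.of_surjective P.d₀ P.surjective (ih
      { A := fun i => P.A (i + 1)
        free := fun i hi => P.free _ (by omega)
        finite := fun i hi => P.finite _ (by omega)
        d₀ := (P.d 0).codRestrict _ hd
        d := fun i => P.d (i + 1)
        surjective := ?_
        exact_zero := fun hn x => ?_
        exact_succ := fun i hi => P.exact_succ (i + 1) (by omega) })
    · rintro ⟨x, hx⟩
      obtain ⟨y, rfl⟩ := (P.exact_zero (Nat.succ_pos n) x).1 hx
      exact ⟨y, rfl⟩
    · rw [← P.exact_succ 0 (by omega) x]
      exact Subtype.ext_iff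

/-- The modules of a resolution of `N` obtained from a resolution of the kernel of `R^m → N`. -/
def consModule (R : Type u) (m : ℕ) (A : ℕ → Type u) : ℕ → Type u
  | 0 => Fin m → R
  | i + 1 => A i

theorem FP.exists_resolution {n : ℕ} {N : Type u} [AddCommGroup N] [Module R N]
    (h : FP R n N) : Nonempty (PartialFreeResolution R N n) := by
  induction n generalizing N with
  | zero =>
    have : Module.Finite R N := h
    obtain ⟨m, f, hf⟩ := Module.Finite.exists_fin' R N
    exact ⟨{ A := fun _ => Fin m → R
             free := fun _ _ => inferInstance
             finite := fun _ _ => inferInstance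
             d₀ := f
             d := fun _ => 0
             surjective := hf
             exact_zero := fun h => absurd h (lt_irrefl _)
             exact_succ := fun i hi => absurd hi (Nat.not_lt_zero _) }⟩
  | succ n ih =>
    obtain ⟨m, f, hf, hk⟩ := h
    obtain ⟨P⟩ := ih hk
    let := P.addCommGroup
    let := P.module
    let i1 : ∀ i, AddCommGroup (consModule R m P.A i) := fun i => match i with
      | 0 => inferInstanceAs (AddCommGroup (Fin m → R))
      | i + 1 => P.addCommGroup i
    let i2 : ∀ i, Module R (consModule R m P.A i) := fun i => match i with
      | 0 => inferInstanceAs (Module R (Fin m → R))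
      | i + 1 => P.module i
    let d : ∀ i, consModule R m P.A (i + 1) →ₗ[R] consModule R m P.A i := fun i => match i with
      | 0 => (LinearMap.ker f).subtype ∘ₗ P.d₀
      | i + 1 => P.d i
    refine ⟨{ A := consModule R m P.A
              addCommGroup := i1
              module := i2
              free := fun i hi => ?_
              finite := fun i hi => ?_
              d₀ := f
              d := d
              surjective := hf
              exact_zero := fun _ x => ?_
              exact_succ := fun i hi => ?_ }⟩
    · cases i with
      | zero => exact inferInstanceAs (Module.Free R (Fin m → R))
      | succ i => exact P.free i (by omega)
    · cases i with
      | zero => exact inferInstanceAs (Module.Finite R (Fin m → R))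
      | succ i => exact P.finite i (by omega)
    · constructor
      · intro hx
        obtain ⟨y, hy⟩ := P.surjective ⟨x, hx⟩
        exact ⟨y, congrArg Subtype.val hy⟩
      · rintro ⟨y, rfl⟩
        exact (P.d₀ y).2
    · cases i with
      | zero =>
        intro x
        exact Iff.trans (Subtype.ext_iff (a1 := P.d₀ x) (a2 := 0)).symm (P.exact_zero (by omega) x)
      | succ i => exact P.exact_succ i (by omega)

/-- The trivial module `ℤ` of an augmented ring `ε : R → ℤ`, lifted to the universe of `R`. -/
def Triv {R : Type u} [Ring R] (_ : R →+* ℤ) : Type u := ULift.{u} ℤ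

instance (ε : R →+* ℤ) : AddCommGroup (Triv ε) := inferInstanceAs (AddCommGroup (ULift.{u} ℤ))

instance (ε : R →+* ℤ) : Module R (Triv ε) := Module.compHom (ULift.{u} ℤ) ε

/-- The additive isomorphism of the trivial module with `ℤ`. -/
def Triv.toInt (ε : R →+* ℤ) : Triv ε ≃+ ℤ := AddEquiv.ulift

theorem Triv.toInt_smul (ε : R →+* ℤ) (r : R) (x : Triv ε) :
    Triv.toInt ε (r • x) = ε r * Triv.toInt ε x := rfl

theorem trivialModuleIsFP_iff (ε : R →+* ℤ) (n : ℕ) :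
    TrivialModuleIsFP ε n ↔ FP R n (Triv ε) := by
  let : Module R ℤ := Module.compHom ℤ ε
  let e : Triv ε ≃ₗ[R] ℤ := { Triv.toInt ε with map_smul' := fun r x => rfl }
  constructor
  · rintro ⟨P⟩
    let := P.addCommGroup
    let := P.module
    exact FP.of_resolution
      { P with
        d₀ := e.symm.toLinearMap ∘ₗ P.d₀
        surjective := e.symm.surjective.comp P.surjective
        exact_zero := fun h x => by
          rw [← P.exact_zero h x]
          exact e.symm.map_eq_zero_iff }
  · intro h
    obtain ⟨P⟩ := h.exists_resolution
    let := P.addCommGroup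
    let := P.module
    exact ⟨{ P with
        d₀ := e.toLinearMap ∘ₗ P.d₀
        surjective := e.surjective.comp P.surjective
        exact_zero := fun h x => by
          rw [← P.exact_zero h x]
          exact e.map_eq_zero_iff }⟩

end Resolution

/-! ### Modules over integral monoid rings -/

section MonoidRing

variable {M : Type u} [Monoid M]

/-- An additive map that commutes with the action of `M` is `ℤM`-linear. -/
def linearOfComm {A B : Type*} [AddCommGroup A] [Module (MonoidAlgebra ℤ M) A]
    [AddCommGroup B] [Module (MonoidAlgebra ℤ M) B] (f : A →+ B)
    (h : ∀ (m : M) (a : A), f (MonoidAlgebra.single m (1 : ℤ) • a) =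
      MonoidAlgebra.single m (1 : ℤ) • f a) : A →ₗ[MonoidAlgebra ℤ M] B where
  toFun := f
  map_add' := map_add f
  map_smul' r a := by
    dsimp only [RingHom.id_apply]
    induction r using MonoidAlgebra.induction_linear with
    | zero => simp
    | add x y hx hy => rw [add_smul, map_add, hx, hy, add_smul]
    | single m k =>
      have : (MonoidAlgebra.single m k : MonoidAlgebra ℤ M) =
          k • MonoidAlgebra.single m (1 : ℤ) := by simp
      rw [this, smul_assoc, map_zsmul, h, ← smul_assoc]

theorem rep_single_smul {V : Type*} [AddCommGroup V] (ρ : Representation ℤ M V) (m : M)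
    (v : ρ.asModule) :
    (MonoidAlgebra.single m (1 : ℤ) • v : ρ.asModule) = ρ m (ρ.asModuleEquiv v) := by
  rw [Representation.single_smul, one_smul]

end MonoidRing

/-! ### Induction along a cocycle -/

/-- A cocycle: a left action of the monoid `Q` on `X` together with a map `Q × X → G` such that
`(x, g) ↦ (q x, c(q, x) g)` is a left action of `Q` on `X × G`. -/
structure Cocycle (Q G X : Type u) [Monoid Q] [Monoid G] where
  act : Q → X → X
  coc : Q → X → G
  act_one : ∀ x, act 1 x = x
  act_mul : ∀ p q x, act (p * q) x = act p (act q x)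
  coc_one : ∀ x, coc 1 x = 1
  coc_mul : ∀ p q x, coc (p * q) x = coc p (act q x) * coc q x

namespace Cocycle

variable {Q G X : Type u} [Monoid Q] [Monoid G] (κ : Cocycle Q G X)

/-- The action of `Q` on the direct sum `X →₀ A` of copies of the `ℤG`-module `A` given by a
cocycle: `q` maps the copy at `x` to the copy at `q x`, through multiplication by `c(q, x)`. -/
def rep (A : Type u) [AddCommGroup A] [Module (MonoidAlgebra ℤ G) A] :
    Representation ℤ Q (X →₀ A) where
  toFun q := Finsupp.lsum ℤ fun x => Finsupp.lsingle (κ.act q x) ∘ₗ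
    (DistribSMul.toAddMonoidHom A
      (MonoidAlgebra.single (κ.coc q x) 1 : MonoidAlgebra ℤ G)).toIntLinearMap
  map_one' := by
    ext x a : 2
    simp [κ.act_one, κ.coc_one, ← MonoidAlgebra.one_def]
  map_mul' p q := by
    ext x a : 2
    simp [κ.act_mul, κ.coc_mul, smul_smul, MonoidAlgebra.single_mul_single]

theorem rep_single {A : Type u} [AddCommGroup A] [Module (MonoidAlgebra ℤ G) A] (q : Q) (x : X)
    (a : A) : κ.rep A q (Finsupp.single x a) =
      Finsupp.single (κ.act q x)
        ((MonoidAlgebra.single (κ.coc q x) 1 : MonoidAlgebra ℤ G) • a) := by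
  simp [rep]

/-- The `ℤQ`-module obtained from the `ℤG`-module `A` by induction along a cocycle. -/
abbrev Ind (A : Type u) [AddCommGroup A] [Module (MonoidAlgebra ℤ G) A] : Type u :=
  (κ.rep A).asModule

/-- The element of the induced module that is `a` in the copy of `A` at `x`. -/
def single {A : Type u} [AddCommGroup A] [Module (MonoidAlgebra ℤ G) A] (x : X) : A →+ κ.Ind A :=
  Finsupp.singleAddHom x

theorem smul_single {A : Type u} [AddCommGroup A] [Module (MonoidAlgebra ℤ G) A] (q : Q) (x : X)
    (a : A) : (MonoidAlgebra.single q (1 : ℤ)) • κ.single x a =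
      κ.single (κ.act q x) ((MonoidAlgebra.single (κ.coc q x) 1 : MonoidAlgebra ℤ G) • a) := by
  rw [rep_single_smul]
  exact κ.rep_single q x a

theorem addHom_ext {A : Type u} {B : Type*} [AddCommGroup A]
    [Module (MonoidAlgebra ℤ G) A] [AddCommGroup B] {f g : κ.Ind A →+ B}
    (h : ∀ x a, f (κ.single x a) = g (κ.single x a)) :
    f = g :=
  Finsupp.addHom_ext h

/-- An additive map out of an induced module, from its values on the summands. -/
def lift {A : Type u} {B : Type*} [AddCommGroup A]
    [Module (MonoidAlgebra ℤ G) A] [AddCommGroup B] (f : X → A →+ B) : κ.Ind A →+ B :=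
  Finsupp.liftAddHom f

@[simp]
theorem lift_single {A : Type u} {B : Type*} [AddCommGroup A]
    [Module (MonoidAlgebra ℤ G) A] [AddCommGroup B] (f : X → A →+ B) (x : X) (a : A) :
    κ.lift f (κ.single x a) = f x a :=
  Finsupp.liftAddHom_apply_single f x a

/-- A linear map out of an induced module, from its values on the summands. -/
def liftLinear {A : Type u} {B : Type*} [AddCommGroup A]
    [Module (MonoidAlgebra ℤ G) A] [AddCommGroup B] [Module (MonoidAlgebra ℤ Q) B] (f : X → A →+ B)
    (h : ∀ q x a, f (κ.act q x) ((MonoidAlgebra.single (κ.coc q x) 1 : MonoidAlgebra ℤ G) • a) =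
      MonoidAlgebra.single q (1 : ℤ) • f x a) : κ.Ind A →ₗ[MonoidAlgebra ℤ Q] B :=
  linearOfComm (κ.lift f) fun q v => by
    let f₁ : κ.Ind A →+ B := (κ.lift f).comp
      (DistribSMul.toAddMonoidHom (κ.Ind A) (MonoidAlgebra.single q 1 : MonoidAlgebra ℤ Q))
    let f₂ : κ.Ind A →+ B :=
      (DistribSMul.toAddMonoidHom B (MonoidAlgebra.single q 1 : MonoidAlgebra ℤ Q)).comp (κ.lift f)
    have : f₁ = f₂ := κ.addHom_ext fun x a => by
      simp only [f₁, f₂, AddMonoidHom.comp_apply, DistribSMul.toAddMonoidHom_apply, lift_single]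
      rw [smul_single, lift_single, h]
    exact DFunLike.congr_fun this v

@[simp]
theorem liftLinear_single {A : Type u} {B : Type*} [AddCommGroup A]
    [Module (MonoidAlgebra ℤ G) A] [AddCommGroup B] [Module (MonoidAlgebra ℤ Q) B] (f : X → A →+ B)
    (h) (x : X) (a : A) :
    κ.liftLinear f h (κ.single x a) = f x a :=
  κ.lift_single f x a

theorem linearMap_ext {A : Type u} {B : Type*} [AddCommGroup A]
    [Module (MonoidAlgebra ℤ G) A] [AddCommGroup B]
    [Module (MonoidAlgebra ℤ Q) B] {f g : κ.Ind A →ₗ[MonoidAlgebra ℤ Q] B}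
    (h : ∀ x a, f (κ.single x a) = g (κ.single x a)) : f = g :=
  LinearMap.toAddMonoidHom_injective (κ.addHom_ext h)

/-- The map of induced modules coming from a linear map. -/
def mapInd {A B : Type u} [AddCommGroup A] [Module (MonoidAlgebra ℤ G) A] [AddCommGroup B]
    [Module (MonoidAlgebra ℤ G) B] (f : A →ₗ[MonoidAlgebra ℤ G] B) :
    κ.Ind A →ₗ[MonoidAlgebra ℤ Q] κ.Ind B :=
  κ.liftLinear (fun x => (κ.single x).comp f.toAddMonoidHom) fun q x a => by
    rw [AddMonoidHom.comp_apply, AddMonoidHom.comp_apply, smul_single]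
    exact congrArg _ (map_smul f _ a)

@[simp]
theorem mapInd_single {A B : Type u} [AddCommGroup A] [Module (MonoidAlgebra ℤ G) A]
    [AddCommGroup B] [Module (MonoidAlgebra ℤ G) B] (f : A →ₗ[MonoidAlgebra ℤ G] B) (x : X)
    (a : A) : κ.mapInd f (κ.single x a) = κ.single x (f a) := by
  rw [mapInd, liftLinear_single]
  rfl

theorem asModuleEquiv_mapInd {A B : Type u} [AddCommGroup A] [Module (MonoidAlgebra ℤ G) A]
    [AddCommGroup B] [Module (MonoidAlgebra ℤ G) B] (f : A →ₗ[MonoidAlgebra ℤ G] B)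
    (v : κ.Ind A) (x : X) :
    (κ.rep B).asModuleEquiv (κ.mapInd f v) x = f ((κ.rep A).asModuleEquiv v x) := by
  have : (κ.rep B).asModuleEquiv.toAddMonoidHom.comp (κ.mapInd f).toAddMonoidHom =
      (Finsupp.mapRange.addMonoidHom f.toAddMonoidHom).comp
        (κ.rep A).asModuleEquiv.toAddMonoidHom :=
    κ.addHom_ext fun x a =>
      (congrArg (κ.rep B).asModuleEquiv (κ.mapInd_single f x a)).trans
        (Finsupp.mapRange_single (hf := map_zero f)).symm
  exact DFunLike.congr_fun (DFunLike.congr_fun this v) x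

open CategoryTheory

/-- Induction along a cocycle, as a functor. -/
def indFunctor : ModuleCat.{u} (MonoidAlgebra ℤ G) ⥤ ModuleCat.{u} (MonoidAlgebra ℤ Q) where
  obj A := ModuleCat.of _ (κ.Ind A)
  map f := ModuleCat.ofHom (κ.mapInd f.hom)
  map_id A := by
    apply ModuleCat.hom_ext
    exact κ.linearMap_ext fun x a => κ.mapInd_single _ x a
  map_comp f g := by
    apply ModuleCat.hom_ext
    refine κ.linearMap_ext fun x a => ?_
    simp

theorem isExactFunctor_indFunctor : IsExactFunctor κ.indFunctor where
  map_shortExact {A B C} _ _ _ _ _ _ f g hf hfg hg := by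
    change Injective (κ.mapInd f) ∧ Exact (κ.mapInd f) (κ.mapInd g) ∧ Surjective (κ.mapInd g)
    refine ⟨fun v w h => ?_, fun v => ⟨fun h => ?_, ?_⟩, fun v => ?_⟩
    · apply (κ.rep A).asModuleEquiv.injective
      ext x
      apply hf
      rw [← asModuleEquiv_mapInd, h, asModuleEquiv_mapInd]
    · have h' : ∀ x, ∃ a, f a = (κ.rep B).asModuleEquiv v x := fun x =>
        (hfg _).1 (by rw [← asModuleEquiv_mapInd, h, map_zero, Finsupp.zero_apply])
      choose s hs using h'
      refine ⟨(κ.rep A).asModuleEquiv.symm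
        (Finsupp.onFinset ((κ.rep B).asModuleEquiv v).support s fun x hx => ?_), ?_⟩
      · rw [Finsupp.mem_support_iff, ← hs]
        exact fun h0 => hx (hf (h0.trans (map_zero f).symm))
      · apply (κ.rep B).asModuleEquiv.injective
        ext x
        rw [asModuleEquiv_mapInd, LinearEquiv.apply_symm_apply, Finsupp.onFinset_apply, hs]
    · rintro ⟨w, rfl⟩
      apply (κ.rep C).asModuleEquiv.injective
      ext x
      rw [asModuleEquiv_mapInd, asModuleEquiv_mapInd, map_zero, Finsupp.zero_apply]
      exact (hfg _).2 ⟨_, rfl⟩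
    · obtain ⟨w, hw⟩ := Finsupp.mapRange_surjective g (map_zero g) hg ((κ.rep C).asModuleEquiv v)
      refine ⟨(κ.rep B).asModuleEquiv.symm w, (κ.rep C).asModuleEquiv.injective ?_⟩
      ext x
      rw [asModuleEquiv_mapInd, LinearEquiv.apply_symm_apply, ← hw, Finsupp.mapRange_apply]

/-- If the module induced from the regular module `ℤG` is of type `FP_n`, then induction preserves
type `FP_n`. -/
theorem fp_ind {n : ℕ} (h : FP (MonoidAlgebra ℤ Q) n (κ.Ind (MonoidAlgebra ℤ G))) {A : Type u}
    [AddCommGroup A] [Module (MonoidAlgebra ℤ G) A] (hA : FP (MonoidAlgebra ℤ G) n A) :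
    FP (MonoidAlgebra ℤ Q) n (κ.Ind A) :=
  κ.isExactFunctor_indFunctor.fp h hA

end Cocycle

/-! ### Type `FP_n` for monoids: retracts, opposites and products -/

section Monoids

variable {M N : Type u} [Monoid M] [Monoid N]

theorem TrivialModuleIsFP.of_retract {R S : Type u} [Ring R] [Ring S] {εR : R →+* ℤ}
    {εS : S →+* ℤ} (i : S →+* R) (r : R →+* S) (hri : ∀ s, r (i s) = s)
    (hi : ∀ s, εR (i s) = εS s) (hr : ∀ x, εS (r x) = εR x) {n : ℕ}
    (h : TrivialModuleIsFP εR n) : TrivialModuleIsFP εS n := by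
  rw [trivialModuleIsFP_iff] at h ⊢
  let c : Triv εS ≃+ Triv εR := (Triv.toInt εS).trans (Triv.toInt εR).symm
  refine FP.of_retract hri (N' := Triv εR)
    ⟨⟨c, map_add c⟩, fun s x => (Triv.toInt εR).injective ?_⟩
    ⟨⟨c.symm, map_add c.symm⟩, fun s x => (Triv.toInt εS).injective ?_⟩ (fun x => ?_) h
  · change εS s * _ = εR (i s) * _
    rw [hi]
    rfl
  · change εR s * _ = εS (r s) * _
    rw [hr]
    rfl
  · exact c.symm_apply_apply x

theorem trivialModuleIsFP_congr {R S : Type u} [Ring R] [Ring S] {εR : R →+* ℤ}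
    {εS : S →+* ℤ} (e : R ≃+* S) (he : ∀ x, εS (e x) = εR x) {n : ℕ} :
    TrivialModuleIsFP εR n ↔ TrivialModuleIsFP εS n := by
  have he' : ∀ x, εR (e.symm x) = εS x := fun x => by rw [← he, e.apply_symm_apply]
  exact ⟨TrivialModuleIsFP.of_retract (e.symm : S →+* R) (e : R →+* S) e.apply_symm_apply he' he,
    TrivialModuleIsFP.of_retract (e : R →+* S) (e.symm : S →+* R) e.symm_apply_apply he he'⟩

@[simp]
theorem augmentation_mapDomain (f : M →* N) (x : MonoidAlgebra ℤ M) :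
    augmentation N (MonoidAlgebra.mapDomainRingHom ℤ f x) = augmentation M x := by
  induction x using MonoidAlgebra.induction_linear with
  | zero => simp
  | add x y hx hy => simp only [map_add, hx, hy]
  | single m k => simp [augmentation_single]

/-- A retract of a monoid of type left-`FP_n` is of type left-`FP_n`. -/
theorem MonoidIsLeftFP.of_retract {n : ℕ} (i : M →* N) (r : N →* M) (hri : ∀ m, r (i m) = m)
    (h : MonoidIsLeftFP n N) : MonoidIsLeftFP n M := by
  refine TrivialModuleIsFP.of_retract (MonoidAlgebra.mapDomainRingHom ℤ i)
    (MonoidAlgebra.mapDomainRingHom ℤ r) (fun s => ?_) (augmentation_mapDomain i)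
    (augmentation_mapDomain r) h
  induction s using MonoidAlgebra.induction_linear with
  | zero => simp
  | add x y hx hy => simp only [map_add, hx, hy]
  | single m k => simp [hri]

theorem MonoidIsLeftFP.of_mulEquiv {n : ℕ} (e : M ≃* N) (h : MonoidIsLeftFP n M) :
    MonoidIsLeftFP n N :=
  h.of_retract e.symm.toMonoidHom e.toMonoidHom e.apply_symm_apply

/-- The opposite of the integral monoid ring of `M` is the integral monoid ring of `Mᵐᵒᵖ`. -/
def opEquiv (M : Type u) [Monoid M] : (MonoidAlgebra ℤ M)ᵐᵒᵖ ≃ₐ[ℤ] MonoidAlgebra ℤ Mᵐᵒᵖ :=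
  (MonoidAlgebra.opRingEquiv.trans
    (MonoidAlgebra.mapRingEquiv Mᵐᵒᵖ (RingEquiv.toOpposite ℤ).symm)).toIntAlgEquiv

@[simp]
theorem opEquiv_op_single (m : M) (k : ℤ) :
    opEquiv M (MulOpposite.op (MonoidAlgebra.single m k)) =
      MonoidAlgebra.single (MulOpposite.op m) k := by
  change MonoidAlgebra.mapRingEquiv _ _ (MonoidAlgebra.opRingEquiv _) = _
  rw [MonoidAlgebra.opRingEquiv_single]
  simp

theorem augmentation_opEquiv (x : (MonoidAlgebra ℤ M)ᵐᵒᵖ) :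
    augmentation Mᵐᵒᵖ (opEquiv M x) = augmentationOp M x := by
  induction x using MulOpposite.rec' with
  | h x =>
    induction x using MonoidAlgebra.induction_linear with
    | zero => simp
    | add x y hx hy => simp only [MulOpposite.op_add, map_add, hx, hy]
    | single m k => rw [opEquiv_op_single, augmentation_single, augmentationOp_op_single]

theorem monoidIsRightFP_iff {n : ℕ} : MonoidIsRightFP n M ↔ MonoidIsLeftFP n Mᵐᵒᵖ :=
  trivialModuleIsFP_congr (opEquiv M).toRingEquiv augmentation_opEquiv

/-- The tensor product of the integral monoid rings of `M` and `N` is that of `M × N`. -/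
def prodEquiv (M N : Type u) [Monoid M] [Monoid N] :
    MonoidAlgebra ℤ M ⊗[ℤ] MonoidAlgebra ℤ N ≃ₐ[ℤ] MonoidAlgebra ℤ (M × N) :=
  AlgEquiv.ofAlgHom
    (Algebra.TensorProduct.lift
      (MonoidAlgebra.mapDomainAlgHom ℤ ℤ (MonoidHom.inl M N))
      (MonoidAlgebra.mapDomainAlgHom ℤ ℤ (MonoidHom.inr M N)) fun x y => by
        induction x using MonoidAlgebra.induction_linear with
        | zero => simp
        | add x x' hx hx' => rw [map_add]; exact hx.add_left hx'
        | single m k =>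
          induction y using MonoidAlgebra.induction_linear with
          | zero => simp
          | add y y' hy hy' => rw [map_add]; exact hy.add_right hy'
          | single n l =>
            simp [Commute, SemiconjBy, MonoidAlgebra.single_mul_single, mul_comm])
    (MonoidAlgebra.lift ℤ _ (M × N)
      { toFun := fun p => MonoidAlgebra.single p.1 1 ⊗ₜ MonoidAlgebra.single p.2 1
        map_one' := rfl
        map_mul' := fun p q => by
          simp [MonoidAlgebra.single_mul_single] })
    (by
      ext p
      · simp [MonoidAlgebra.single_mul_single])
    (by
      ext m
      · simp [MonoidAlgebra.one_def]
      · simp [MonoidAlgebra.one_def])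

theorem prodEquiv_tmul_single (m : M) (n : N) (k l : ℤ) :
    prodEquiv M N (MonoidAlgebra.single m k ⊗ₜ MonoidAlgebra.single n l) =
      MonoidAlgebra.single (m, n) (k * l) := by
  simp [prodEquiv, MonoidAlgebra.single_mul_single]

theorem augmentation_prodEquiv (x : MonoidAlgebra ℤ M) (y : MonoidAlgebra ℤ N) :
    augmentation (M × N) (prodEquiv M N (x ⊗ₜ y)) = augmentation M x * augmentation N y := by
  induction x using MonoidAlgebra.induction_linear with
  | zero => simp
  | add x x' hx hx' => simp only [TensorProduct.add_tmul, map_add, hx, hx', add_mul]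
  | single m k =>
    induction y using MonoidAlgebra.induction_linear with
    | zero => simp
    | add y y' hy hy' => simp only [TensorProduct.tmul_add, map_add, hy, hy', mul_add]
    | single n l => simp only [prodEquiv_tmul_single, augmentation_single]

theorem monoidIsBiFP_iff_prod {n : ℕ} : MonoidIsBiFP n M ↔ MonoidIsLeftFP n (M × Mᵐᵒᵖ) := by
  let e := (Algebra.TensorProduct.congr (AlgEquiv.refl (R := ℤ) (A₁ := MonoidAlgebra ℤ M))
    (opEquiv M)).trans (prodEquiv M Mᵐᵒᵖ)
  refine trivialModuleIsFP_congr e.toRingEquiv fun x => ?_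
  change augmentation _ (e x) = augmentationBi M x
  induction x with
  | zero => simp
  | add x y hx hy => simp only [map_add, hx, hy]
  | tmul x y =>
    rw [augmentationBi_tmul, ← augmentation_opEquiv]
    exact augmentation_prodEquiv x (opEquiv M y)

/-- The additive map on `ℤX` with prescribed values on `X`. -/
def liftAdd {X : Type u} {B : Type*} [AddCommGroup B] (f : X → B) : MonoidAlgebra ℤ X →+ B :=
  (Finsupp.liftAddHom fun m => zmultiplesHom B (f m)).comp
    MonoidAlgebra.coeffAddEquiv.toAddMonoidHom

@[simp]
theorem liftAdd_single {X : Type u} {B : Type*} [AddCommGroup B] (f : X → B) (m : X) (k : ℤ) :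
    liftAdd f (MonoidAlgebra.single m k) = k • f m := by
  simp [liftAdd]

/-- The module `ℤ[X × G]` of a cocycle is finitely generated and projective if the `Q`-set `X × G`
is a retract of a free `Q`-set `L × Q` with `L` finite.  The map to `L × Q` is given by an invariant
map `p` and an equivariant map `s`, and the map back by the images `t l` of the elements
`(l, 1)`. -/
theorem Cocycle.fp_ind_regular {Q G X L : Type u} [Monoid Q] [Monoid G] [Finite L]
    (κ : Cocycle Q G X) (p : X → G → L) (s : X → G → Q) (t : L → X × G)
    (hp : ∀ q x g, p (κ.act q x) (κ.coc q x * g) = p x g)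
    (hs : ∀ q x g, s (κ.act q x) (κ.coc q x * g) = q * s x g)
    (h₁ : ∀ x g, κ.act (s x g) (t (p x g)).1 = x)
    (h₂ : ∀ x g, κ.coc (s x g) (t (p x g)).1 * (t (p x g)).2 = g) (n : ℕ) :
    FP (MonoidAlgebra ℤ Q) n (κ.Ind (MonoidAlgebra ℤ G)) := by
  let σ : κ.Ind (MonoidAlgebra ℤ G) →ₗ[MonoidAlgebra ℤ Q] (L →₀ MonoidAlgebra ℤ Q) :=
    κ.liftLinear (fun x => liftAdd fun g =>
      Finsupp.single (p x g) (MonoidAlgebra.single (s x g) (1 : ℤ))) fun q x a => by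
      induction a using MonoidAlgebra.induction_linear with
      | zero => simp
      | add a b ha hb => simp only [smul_add, map_add, ha, hb]
      | single g k =>
        simp [MonoidAlgebra.single_mul_single, hp, hs]
  let τ : (L →₀ MonoidAlgebra ℤ Q) →ₗ[MonoidAlgebra ℤ Q] κ.Ind (MonoidAlgebra ℤ G) :=
    Finsupp.linearCombination _ fun l => κ.single (t l).1 (MonoidAlgebra.single (t l).2 (1 : ℤ))
  have hτσ : τ ∘ₗ σ = LinearMap.id := κ.linearMap_ext fun x a => by
    rw [LinearMap.comp_apply, Cocycle.liftLinear_single]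
    induction a using MonoidAlgebra.induction_linear with
    | zero => simp
    | add a b ha hb => simp only [map_add, ha, hb]
    | single g k =>
      rw [liftAdd_single, map_zsmul, Finsupp.linearCombination_single, κ.smul_single, smul_eq_mul,
        MonoidAlgebra.single_mul_single, h₁, h₂, ← map_zsmul]
      simp
  have : Module.Projective (MonoidAlgebra ℤ Q) (κ.Ind (MonoidAlgebra ℤ G)) :=
    Module.Projective.of_split σ τ hτσ
  have : Module.Finite (MonoidAlgebra ℤ Q) (κ.Ind (MonoidAlgebra ℤ G)) :=
    Module.Finite.of_surjective τ fun x => ⟨σ x, LinearMap.congr_fun hτσ x⟩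
  exact FP.of_projective n

theorem single_smul_triv (m : M) (k : ℤ)
    (z : Triv (augmentation M : MonoidAlgebra ℤ M →+* ℤ)) :
    (MonoidAlgebra.single m k : MonoidAlgebra ℤ M) • z = k • z := by
  apply (Triv.toInt _).injective
  rw [Triv.toInt_smul, map_zsmul, smul_eq_mul]
  exact congrArg (· * _) (augmentation_single M m k)

theorem MonoidIsLeftFP.prod {n : ℕ} (hM : MonoidIsLeftFP n M) (hN : MonoidIsLeftFP n N) :
    MonoidIsLeftFP n (M × N) := by
  rw [MonoidIsLeftFP, trivialModuleIsFP_iff] at hM hN ⊢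
  let κ : Cocycle (M × N) M N :=
    { act := fun q x => q.2 * x
      coc := fun q _ => q.1
      act_one := fun x => one_mul x
      act_mul := fun p q x => mul_assoc _ _ _
      coc_one := fun _ => rfl
      coc_mul := fun _ _ _ => rfl }
  have h := κ.fp_ind (κ.fp_ind_regular (L := PUnit) (fun _ _ => PUnit.unit) (fun x g => (g, x))
    (fun _ => (1, 1)) (fun _ _ _ => rfl) (fun _ _ _ => rfl) (fun x g => mul_one x)
    (fun x g => mul_one g) n) hM
  -- The induced module of `ℤ` is `ℤN`, with `M × N` acting through `N`.
  let φ : MonoidAlgebra ℤ (M × N) →+* MonoidAlgebra ℤ N :=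
    MonoidAlgebra.mapDomainRingHom ℤ (MonoidHom.snd M N)
  let f : κ.Ind (Triv (augmentation M : MonoidAlgebra ℤ M →+* ℤ)) →ₗ[MonoidAlgebra ℤ (M × N)]
      (ModuleCat.restrictScalars φ).obj (ModuleCat.of (MonoidAlgebra ℤ N) (MonoidAlgebra ℤ N)) :=
    κ.liftLinear (fun x => (MonoidAlgebra.singleAddHom x).comp (Triv.toInt _).toAddMonoidHom)
      fun q x a => by
        rw [single_smul_triv, one_smul]
        change _ = φ (MonoidAlgebra.single q 1) *
          (MonoidAlgebra.single x (Triv.toInt _ a) : MonoidAlgebra ℤ N)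
        simp [φ, MonoidAlgebra.single_mul_single, κ]
        rfl
  let g : MonoidAlgebra ℤ N →+ κ.Ind (Triv (augmentation M : MonoidAlgebra ℤ M →+* ℤ)) :=
    liftAdd fun x => κ.single x ((Triv.toInt _).symm 1)
  have hgf : g.comp f.toAddMonoidHom = AddMonoidHom.id _ := κ.addHom_ext fun x a => by
    have h1 : f (κ.single x a) = (MonoidAlgebra.single x (Triv.toInt _ a) : MonoidAlgebra ℤ N) :=
      κ.liftLinear_single _ _ x a
    refine (congrArg g h1).trans ?_
    rw [liftAdd_single, ← map_zsmul, ← map_zsmul]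
    simp
  have hfg : f.toAddMonoidHom.comp g = AddMonoidHom.id _ := by
    refine MonoidAlgebra.addMonoidHom_ext fun x k => ?_
    rw [AddMonoidHom.comp_apply, liftAdd_single, map_zsmul]
    have h1 : f (κ.single x ((Triv.toInt _).symm 1)) =
      (MonoidAlgebra.single x (Triv.toInt _ ((Triv.toInt _).symm 1)) : MonoidAlgebra ℤ N) :=
      κ.liftLinear_single _ _ x _
    refine (congrArg (k • ·) h1).trans ?_
    change k • (MonoidAlgebra.single x (1 : ℤ) : MonoidAlgebra ℤ N) = MonoidAlgebra.single x k
    simp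
  have h' := FP.equiv (LinearEquiv.ofBijective f
    ⟨LeftInverse.injective (g := g) (DFunLike.congr_fun hgf),
      RightInverse.surjective (g := g) (DFunLike.congr_fun hfg)⟩) h
  refine FP.equiv ?_ (FP.restrictScalars φ h' hN)
  exact
    { (AddEquiv.refl (ULift.{u} ℤ) : _ ≃+ _) with
      map_smul' := fun r z => by
        apply (Triv.toInt _).injective
        exact congrArg (fun w : ℤ => w * (show ULift.{u} ℤ from z).down)
          (augmentation_mapDomain (MonoidHom.snd M N) r) }

theorem monoidIsBiFP_iff {n : ℕ} :
    MonoidIsBiFP n M ↔ MonoidIsLeftFP n M ∧ MonoidIsRightFP n M := by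
  rw [monoidIsBiFP_iff_prod, monoidIsRightFP_iff]
  exact ⟨fun h => ⟨h.of_retract (MonoidHom.inl M Mᵐᵒᵖ) (MonoidHom.fst M Mᵐᵒᵖ) fun _ => rfl,
    h.of_retract (MonoidHom.inr M Mᵐᵒᵖ) (MonoidHom.snd M Mᵐᵒᵖ) fun _ => rfl⟩,
    fun h => h.1.prod h.2⟩

end Monoids

/-! ### Induction from a maximal subgroup to a minimal left ideal -/

section Transversal

variable {Q G X : Type u} [Monoid Q] [Monoid G]

/-- Suppose that every element of a left ideal of the monoid `Q` is uniquely of the form `r x * ι g`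
with `x ∈ X` and `g ∈ G`.  Then left multiplication by `Q` is described by a cocycle. -/
def Cocycle.ofTransversal (ι : G →ₙ* Q) (r : X → Q) (hr : ∀ x, r x * ι 1 = r x)
    (huniq : ∀ x g y h, r x * ι g = r y * ι h → x = y ∧ g = h)
    (hex : ∀ q x, ∃ p : X × G, q * r x = r p.1 * ι p.2) : Cocycle Q G X where
  act q x := (hex q x).choose.1
  coc q x := (hex q x).choose.2
  act_one x := by
    refine (huniq _ (hex 1 x).choose.2 x 1 ?_).1
    rw [← (hex 1 x).choose_spec, one_mul, hr]
  coc_one x := by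
    refine (huniq (hex 1 x).choose.1 _ x 1 ?_).2
    rw [← (hex 1 x).choose_spec, one_mul, hr]
  act_mul p q x := by
    refine (huniq _ (hex (p * q) x).choose.2 _
      ((hex p (hex q x).choose.1).choose.2 * (hex q x).choose.2) ?_).1
    rw [← (hex (p * q) x).choose_spec, map_mul, ← mul_assoc, ← (hex p _).choose_spec, mul_assoc,
      mul_assoc, ← (hex q x).choose_spec]
  coc_mul p q x := by
    refine (huniq (hex (p * q) x).choose.1 _ (hex p (hex q x).choose.1).choose.1 _ ?_).2
    rw [← (hex (p * q) x).choose_spec, map_mul, ← mul_assoc, ← (hex p _).choose_spec, mul_assoc,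
      mul_assoc, ← (hex q x).choose_spec]

theorem Cocycle.ofTransversal_spec (ι : G →ₙ* Q) (r : X → Q) (hr : ∀ x, r x * ι 1 = r x)
    (huniq : ∀ x g y h, r x * ι g = r y * ι h → x = y ∧ g = h)
    (hex : ∀ q x, ∃ p : X × G, q * r x = r p.1 * ι p.2) (q : Q) (x : X) :
    q * r x = r ((ofTransversal ι r hr huniq hex).act q x) *
      ι ((ofTransversal ι r hr huniq hex).coc q x) :=
  (hex q x).choose_spec

/-- Induction along `Cocycle.ofTransversal` preserves type `FP_n` if the left ideal is generated by
the idempotent `ι 1`: then the module `ℤ[X × G]` is a direct summand of `ℤQ`. -/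
theorem Cocycle.fp_ind_ofTransversal (ι : G →ₙ* Q) (r : X → Q) (hr : ∀ x, r x * ι 1 = r x)
    (huniq : ∀ x g y h, r x * ι g = r y * ι h → x = y ∧ g = h)
    (hex : ∀ q x, ∃ p : X × G, q * r x = r p.1 * ι p.2) (he : ∃ p : X × G, ι 1 = r p.1 * ι p.2)
    {n : ℕ} {A : Type u} [AddCommGroup A] [Module (MonoidAlgebra ℤ G) A]
    (hA : FP (MonoidAlgebra ℤ G) n A) :
    FP (MonoidAlgebra ℤ Q) n ((ofTransversal ι r hr huniq hex).Ind A) := by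
  obtain ⟨t, ht⟩ := he
  have spec := ofTransversal_spec ι r hr huniq hex
  have key : ∀ x g, r ((ofTransversal ι r hr huniq hex).act (r x * ι g) t.1) *
      ι ((ofTransversal ι r hr huniq hex).coc (r x * ι g) t.1 * t.2) = r x * ι g := fun x g => by
    rw [map_mul, ← mul_assoc, ← spec, mul_assoc, ← ht, mul_assoc, ← map_mul, mul_one]
  refine fp_ind _ (fp_ind_regular (L := PUnit) _ (fun _ _ => PUnit.unit) (fun x g => r x * ι g)
    (fun _ => t) (fun _ _ _ => rfl) (fun q x g => ?_) (fun x g => ?_) (fun x g => ?_) n) hA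
  · rw [map_mul, ← mul_assoc, ← spec, mul_assoc]
  · exact (huniq _ _ _ _ (key x g)).1
  · exact (huniq _ _ _ _ (key x g)).2

end Transversal

/-! ### The local submodule at an idempotent -/

section Corner

variable {Q G : Type u} [Monoid Q] [Monoid G] (ι : G →ₙ* Q)

/-- The subgroup `eN` of a `ℤQ`-module `N`, where `e = ι 1`. -/
def cornerSubgroup (N : Type u) [AddCommGroup N] [Module (MonoidAlgebra ℤ Q) N] :
    AddSubgroup N where
  carrier := {x | (MonoidAlgebra.single (ι 1) 1 : MonoidAlgebra ℤ Q) • x = x}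
  zero_mem' := smul_zero _
  add_mem' {x y} hx hy := by
    change _ • (x + y) = x + y
    rw [smul_add, hx, hy]
  neg_mem' {x} hx := by
    change _ • (-x) = -x
    rw [smul_neg, hx]

variable {N : Type u} [AddCommGroup N] [Module (MonoidAlgebra ℤ Q) N]

theorem single_mul_smul (p q : Q) (x : N) :
    (MonoidAlgebra.single (p * q) 1 : MonoidAlgebra ℤ Q) • x =
      (MonoidAlgebra.single p 1 : MonoidAlgebra ℤ Q) •
        (MonoidAlgebra.single q 1 : MonoidAlgebra ℤ Q) • x := by
  rw [smul_smul, MonoidAlgebra.single_mul_single, one_mul]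

theorem mem_cornerSubgroup {x : N} : x ∈ cornerSubgroup ι N ↔
    (MonoidAlgebra.single (ι 1) 1 : MonoidAlgebra ℤ Q) • x = x := Iff.rfl

theorem smul_mem_cornerSubgroup (g : G) (x : N) :
    (MonoidAlgebra.single (ι g) 1 : MonoidAlgebra ℤ Q) • x ∈ cornerSubgroup ι N := by
  change _ • _ • _ = _
  rw [← single_mul_smul, ← map_mul, one_mul]

/-- The action of `G` on `eN`. -/
def cornerRep (N : Type u) [AddCommGroup N] [Module (MonoidAlgebra ℤ Q) N] :
    Representation ℤ G (cornerSubgroup ι N) where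
  toFun g := AddMonoidHom.toIntLinearMap
    { toFun := fun x => ⟨(MonoidAlgebra.single (ι g) 1 : MonoidAlgebra ℤ Q) • x.1,
        smul_mem_cornerSubgroup ι g x.1⟩
      map_zero' := Subtype.ext (smul_zero _)
      map_add' := fun x y => Subtype.ext (smul_add _ _ _) }
  map_one' := by
    ext x
    exact x.2
  map_mul' g h := by
    ext x
    change (MonoidAlgebra.single (ι (g * h)) 1 : MonoidAlgebra ℤ Q) • x.1 = _ • _ • x.1
    rw [map_mul, single_mul_smul]

/-- The `ℤG`-module `eN`. -/
abbrev Corner (N : Type u) [AddCommGroup N] [Module (MonoidAlgebra ℤ Q) N] : Type u :=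
  (cornerRep ι N).asModule

/-- The inclusion of `eN` in `N`. -/
def Corner.incl : Corner ι N →+ N := (cornerSubgroup ι N).subtype

theorem Corner.incl_injective : Injective (Corner.incl ι : Corner ι N →+ N) :=
  Subtype.val_injective

theorem Corner.incl_smul (g : G) (x : Corner ι N) :
    Corner.incl ι ((MonoidAlgebra.single g 1 : MonoidAlgebra ℤ G) • x) =
      (MonoidAlgebra.single (ι g) 1 : MonoidAlgebra ℤ Q) • Corner.incl ι x := by
  rw [rep_single_smul]
  rfl

theorem Corner.one_smul_incl (x : Corner ι N) :
    (MonoidAlgebra.single (ι 1) 1 : MonoidAlgebra ℤ Q) • Corner.incl ι x = Corner.incl ι x :=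
  x.2

/-- An element of `N` fixed by `e`, as an element of `eN`. -/
def Corner.mk (x : N) (hx : x ∈ cornerSubgroup ι N) : Corner ι N :=
  (⟨x, hx⟩ : cornerSubgroup ι N)

@[simp]
theorem Corner.incl_mk (x : N) (hx : x ∈ cornerSubgroup ι N) :
    Corner.incl ι (Corner.mk ι x hx) = x := rfl

/-- The map `eN → eN'` induced by a linear map `N → N'`. -/
def Corner.map {N' : Type u} [AddCommGroup N'] [Module (MonoidAlgebra ℤ Q) N']
    (f : N →ₗ[MonoidAlgebra ℤ Q] N') : Corner ι N →ₗ[MonoidAlgebra ℤ G] Corner ι N' :=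
  linearOfComm
    { toFun := fun x => Corner.mk ι (f (Corner.incl ι x)) (by
        rw [mem_cornerSubgroup, ← map_smul, Corner.one_smul_incl])
      map_zero' := Corner.incl_injective ι (by simp)
      map_add' := fun x y => Corner.incl_injective ι (by simp) }
    fun g x => Corner.incl_injective ι (by
      change f (Corner.incl ι _) = _
      rw [Corner.incl_smul, Corner.incl_smul, map_smul]
      rfl)

@[simp]
theorem Corner.incl_map {N' : Type u} [AddCommGroup N'] [Module (MonoidAlgebra ℤ Q) N']
    (f : N →ₗ[MonoidAlgebra ℤ Q] N') (x : Corner ι N) :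
    Corner.incl ι (Corner.map ι f x) = f (Corner.incl ι x) := rfl

open CategoryTheory

/-- The functor `N ↦ eN`. -/
def cornerFunctor : ModuleCat.{u} (MonoidAlgebra ℤ Q) ⥤ ModuleCat.{u} (MonoidAlgebra ℤ G) where
  obj N := ModuleCat.of _ (Corner ι N)
  map f := ModuleCat.ofHom (Corner.map ι f.hom)
  map_id _ := rfl
  map_comp _ _ := rfl

theorem isExactFunctor_cornerFunctor : IsExactFunctor (cornerFunctor ι) where
  map_shortExact {A B C} _ _ _ _ _ _ f g hf hfg hg := by
    change Injective (Corner.map ι f) ∧ Exact (Corner.map ι f) (Corner.map ι g) ∧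
      Surjective (Corner.map ι g)
    refine ⟨fun x y h => Corner.incl_injective ι (hf ?_), fun x => ⟨fun h => ?_, ?_⟩, fun x => ?_⟩
    · rw [← Corner.incl_map, h, Corner.incl_map]
    · obtain ⟨a, ha⟩ := (hfg (Corner.incl ι x)).1 (by rw [← Corner.incl_map, h, map_zero])
      refine ⟨Corner.mk ι a ((mem_cornerSubgroup ι).2 (hf ?_)), Corner.incl_injective ι ?_⟩
      · rw [map_smul, ha, Corner.one_smul_incl]
      · rw [Corner.incl_map, Corner.incl_mk, ha]
    · rintro ⟨y, rfl⟩
      apply Corner.incl_injective ι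
      rw [Corner.incl_map, Corner.incl_map, map_zero]
      exact (hfg _).2 ⟨_, rfl⟩
    · obtain ⟨b, hb⟩ := hg (Corner.incl ι x)
      refine ⟨Corner.mk ι _ (smul_mem_cornerSubgroup ι 1 b), Corner.incl_injective ι ?_⟩
      rw [Corner.incl_map, Corner.incl_mk, map_smul, hb, Corner.one_smul_incl]

/-- The trivial module over `ℤG` is of type `FP_n` if the one over `ℤQ` is and every element of the
right ideal `eQ` is uniquely of the form `ι g * t l`, where `l` ranges over a finite set: then `eℤQ`
is a finitely generated free `ℤG`-module. -/
theorem MonoidIsLeftFP.corner {L : Type u} [Finite L] (t : L → Q) (ht : ∀ l, ι 1 * t l = t l)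
    (huniq : ∀ l g m h, ι g * t l = ι h * t m → l = m ∧ g = h)
    (hex : ∀ q, ∃ p : L × G, ι 1 * q = ι p.2 * t p.1) {n : ℕ} (hQ : MonoidIsLeftFP n Q) :
    MonoidIsLeftFP n G := by
  rw [MonoidIsLeftFP, trivialModuleIsFP_iff] at hQ ⊢
  choose p hp using hex
  have hpι : ∀ g q, (p (ι g * q)).1 = (p q).1 ∧ (p (ι g * q)).2 = g * (p q).2 := fun g q => by
    refine huniq _ _ _ _ ?_
    rw [← hp, map_mul, mul_assoc, ← hp, ← mul_assoc, ← mul_assoc, ← map_mul, ← map_mul, one_mul,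
      mul_one]
  let s : MonoidAlgebra ℤ Q →+ (L →₀ MonoidAlgebra ℤ G) :=
    liftAdd fun q => Finsupp.single (p q).1 (MonoidAlgebra.single (p q).2 (1 : ℤ))
  have hs : ∀ g x, s ((MonoidAlgebra.single (ι g) 1 : MonoidAlgebra ℤ Q) • x) =
      (MonoidAlgebra.single g 1 : MonoidAlgebra ℤ G) • s x := fun g x => by
    induction x using MonoidAlgebra.induction_linear with
    | zero => simp
    | add x y hx hy => rw [smul_add, map_add, hx, hy, map_add, smul_add]
    | single q k =>
      rw [smul_eq_mul, MonoidAlgebra.single_mul_single, one_mul, liftAdd_single, liftAdd_single,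
        (hpι g q).1, (hpι g q).2]
      simp [MonoidAlgebra.single_mul_single]
  let σ : Corner ι (MonoidAlgebra ℤ Q) →ₗ[MonoidAlgebra ℤ G] (L →₀ MonoidAlgebra ℤ G) :=
    linearOfComm (s.comp (Corner.incl ι)) fun g x => by
      rw [AddMonoidHom.comp_apply, Corner.incl_smul, hs]
      rfl
  let τ : (L →₀ MonoidAlgebra ℤ G) →ₗ[MonoidAlgebra ℤ G] Corner ι (MonoidAlgebra ℤ Q) :=
    Finsupp.linearCombination _ fun l => Corner.mk ι (MonoidAlgebra.single (t l) 1) (by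
      rw [mem_cornerSubgroup, smul_eq_mul, MonoidAlgebra.single_mul_single, ht, one_mul])
  have hτs : ∀ x : MonoidAlgebra ℤ Q, Corner.incl ι (τ (s x)) =
      (MonoidAlgebra.single (ι 1) 1 : MonoidAlgebra ℤ Q) • x := fun x => by
    induction x using MonoidAlgebra.induction_linear with
    | zero => simp
    | add x y hx hy => rw [map_add, map_add, map_add, hx, hy, smul_add]
    | single q k =>
      rw [liftAdd_single, map_zsmul, map_zsmul, Finsupp.linearCombination_single, Corner.incl_smul,
        Corner.incl_mk, smul_eq_mul, smul_eq_mul, MonoidAlgebra.single_mul_single,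
        MonoidAlgebra.single_mul_single, ← hp]
      simp
  have hτσ : τ ∘ₗ σ = LinearMap.id := LinearMap.ext fun x =>
    Corner.incl_injective ι ((hτs _).trans (Corner.one_smul_incl ι x))
  have : Module.Projective (MonoidAlgebra ℤ G) (Corner ι (MonoidAlgebra ℤ Q)) :=
    Module.Projective.of_split σ τ hτσ
  have : Module.Finite (MonoidAlgebra ℤ G) (Corner ι (MonoidAlgebra ℤ Q)) :=
    Module.Finite.of_surjective τ fun x => ⟨σ x, LinearMap.congr_fun hτσ x⟩
  have hreg : FP (MonoidAlgebra ℤ G) n (Corner ι (MonoidAlgebra ℤ Q)) := FP.of_projective n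
  have h := (isExactFunctor_cornerFunctor ι).fp hreg hQ
  -- All of `ℤ` is fixed by `e`.
  let f : Corner ι (Triv (augmentation Q : MonoidAlgebra ℤ Q →+* ℤ)) →ₗ[MonoidAlgebra ℤ G]
      Triv (augmentation G : MonoidAlgebra ℤ G →+* ℤ) :=
    linearOfComm (((Triv.toInt _).trans (Triv.toInt _).symm).toAddMonoidHom.comp (Corner.incl ι))
      fun g x => by
        rw [AddMonoidHom.comp_apply, AddMonoidHom.comp_apply, Corner.incl_smul, single_smul_triv,
          single_smul_triv, one_smul, one_smul]
  refine FP.equiv (LinearEquiv.ofBijective f ⟨fun x y hxy => Corner.incl_injective ι ?_,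
    fun z => ?_⟩) h
  · exact ((Triv.toInt _).trans (Triv.toInt _).symm).injective hxy
  · refine ⟨Corner.mk ι (((Triv.toInt _).trans (Triv.toInt _).symm) z) ?_, ?_⟩
    · rw [mem_cornerSubgroup, single_smul_triv, one_smul]
    · exact ((Triv.toInt (augmentation G : MonoidAlgebra ℤ G →+* ℤ)).trans
        (Triv.toInt (augmentation Q : MonoidAlgebra ℤ Q →+* ℤ)).symm).symm_apply_apply z

end Corner

/-! ### Completely simple semigroups -/

section Semigroup

variable {U : Type u} [Semigroup U]

/-- Each element of the semigroup `U` is recovered, by a further multiplication, from any of its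
multiples.  This is an algebraic form of complete simplicity. -/
structure RecoversFactors (U : Type u) [Semigroup U] : Prop where
  left : ∀ x y : U, ∃ z, z * (y * x) = x
  right : ∀ x y : U, ∃ z, x * y * z = x

theorem IsCompletelySimple.nonempty (hU : IsCompletelySimple U) : Nonempty U :=
  let ⟨_, hA⟩ := hU.exists_minimal_left
  ⟨hA.1.1.some⟩

/-- The union of the translates `A u` of a minimal left ideal `A` is an ideal, hence everything, and
minimality of `A` gives the claim for each translate. -/
theorem IsCompletelySimple.recoversFactors (hU : IsCompletelySimple U) : RecoversFactors U where
  left := by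
    obtain ⟨A, hA⟩ := hU.exists_minimal_left
    have huniv : {x : U | ∃ a ∈ A, ∃ u, x = a * u} = Set.univ := by
      refine hU.simple _ ⟨?_, ?_⟩ ⟨?_, ?_⟩
      · obtain ⟨a, ha⟩ := hA.1.1
        exact ⟨a * a, a, ha, a, rfl⟩
      · rintro s _ ⟨a, ha, u, rfl⟩
        exact ⟨s * a, hA.1.2 s a ha, u, (mul_assoc _ _ _).symm⟩
      · obtain ⟨a, ha⟩ := hA.1.1
        exact ⟨a * a, a, ha, a, rfl⟩
      · rintro s _ ⟨a, ha, u, rfl⟩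
        exact ⟨a, ha, u * s, mul_assoc _ _ _⟩
    intro x y
    obtain ⟨a, ha, u, rfl⟩ : x ∈ {x : U | ∃ a ∈ A, ∃ u, x = a * u} := huniv ▸ Set.mem_univ x
    have hB : IsLeftIdeal {b ∈ A | ∃ z, z * (y * (a * u)) = b * u} := by
      refine ⟨⟨y * (y * a), hA.1.2 _ _ (hA.1.2 _ _ ha), y, by simp only [mul_assoc]⟩, ?_⟩
      rintro s b ⟨hb, z, hz⟩
      exact ⟨hA.1.2 _ _ hb, s * z, by rw [mul_assoc, hz, mul_assoc]⟩
    exact (hA.2 hB (Set.sep_subset _ _) ha).2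
  right := by
    obtain ⟨A, hA⟩ := hU.exists_minimal_right
    have huniv : {x : U | ∃ a ∈ A, ∃ u, x = u * a} = Set.univ := by
      refine hU.simple _ ⟨?_, ?_⟩ ⟨?_, ?_⟩
      · obtain ⟨a, ha⟩ := hA.1.1
        exact ⟨a * a, a, ha, a, rfl⟩
      · rintro s _ ⟨a, ha, u, rfl⟩
        exact ⟨a, ha, s * u, (mul_assoc _ _ _).symm⟩
      · obtain ⟨a, ha⟩ := hA.1.1
        exact ⟨a * a, a, ha, a, rfl⟩
      · rintro s _ ⟨a, ha, u, rfl⟩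
        exact ⟨a * s, hA.1.2 s a ha, u, mul_assoc _ _ _⟩
    intro x y
    obtain ⟨a, ha, u, rfl⟩ : x ∈ {x : U | ∃ a ∈ A, ∃ u, x = u * a} := huniv ▸ Set.mem_univ x
    have hB : IsRightIdeal {b ∈ A | ∃ z, u * a * y * z = u * b} := by
      refine ⟨⟨a * y * y, hA.1.2 _ _ (hA.1.2 _ _ ha), y, by simp only [mul_assoc]⟩, ?_⟩
      rintro s b ⟨hb, z, hz⟩
      exact ⟨hA.1.2 _ _ hb, z * s, by rw [← mul_assoc, hz, mul_assoc]⟩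
    exact (hA.2 hB (Set.sep_subset _ _) ha).2

theorem RecoversFactors.op (h : RecoversFactors U) : RecoversFactors Uᵐᵒᵖ where
  left x y := by
    obtain ⟨z, hz⟩ := h.right x.unop y.unop
    exact ⟨MulOpposite.op z, MulOpposite.unop_injective hz⟩
  right x y := by
    obtain ⟨z, hz⟩ := h.left x.unop y.unop
    exact ⟨MulOpposite.op z, MulOpposite.unop_injective hz⟩

/-- The principal right ideal `xU`. -/
def principalRight (x : U) : Set U := {y | ∃ z, x * z = y}

/-- The principal left ideal `Ux`. -/
def principalLeft (x : U) : Set U := {y | ∃ z, z * x = y}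

theorem RecoversFactors.mem_principalRight (h : RecoversFactors U) (x : U) :
    x ∈ principalRight x := by
  obtain ⟨z, hz⟩ := h.right x x
  exact ⟨x * z, by rw [← mul_assoc, hz]⟩

theorem RecoversFactors.mem_principalLeft (h : RecoversFactors U) (x : U) :
    x ∈ principalLeft x := by
  obtain ⟨z, hz⟩ := h.left x x
  exact ⟨z * x, by rw [mul_assoc, hz]⟩

theorem RecoversFactors.principalRight_mul (h : RecoversFactors U) (x y : U) :
    principalRight (x * y) = principalRight x := by
  ext w
  constructor
  · rintro ⟨z, rfl⟩
    exact ⟨y * z, (mul_assoc _ _ _).symm⟩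
  · rintro ⟨z, rfl⟩
    obtain ⟨v, hv⟩ := h.right x y
    exact ⟨v * z, by rw [← mul_assoc, hv]⟩

theorem RecoversFactors.principalLeft_mul (h : RecoversFactors U) (x y : U) :
    principalLeft (x * y) = principalLeft y := by
  ext w
  constructor
  · rintro ⟨z, rfl⟩
    exact ⟨z * x, mul_assoc _ _ _⟩
  · rintro ⟨z, rfl⟩
    obtain ⟨v, hv⟩ := h.left y x
    exact ⟨z * v, by rw [mul_assoc, hv]⟩

/-- Every left ideal is a union of principal left ideals. -/
theorem RecoversFactors.finite_leftIdeals_iff (h : RecoversFactors U) :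
    {A : Set U | IsLeftIdeal A}.Finite ↔ (Set.range (principalLeft : U → Set U)).Finite := by
  constructor
  · intro hf
    refine hf.subset ?_
    rintro _ ⟨x, rfl⟩
    refine ⟨⟨x, h.mem_principalLeft x⟩, ?_⟩
    rintro s _ ⟨z, rfl⟩
    exact ⟨s * z, mul_assoc _ _ _⟩
  · intro hf
    refine (hf.finite_subsets.image Set.sUnion).subset fun A hA => ?_
    refine ⟨principalLeft '' A, Set.image_subset_range _ _, ?_⟩
    ext x
    constructor
    · rintro ⟨_, ⟨a, ha, rfl⟩, z, rfl⟩
      exact hA.2 z a ha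
    · exact fun hx => ⟨_, ⟨x, hx, rfl⟩, h.mem_principalLeft x⟩

/-- Every right ideal is a union of principal right ideals. -/
theorem RecoversFactors.finite_rightIdeals_iff (h : RecoversFactors U) :
    {A : Set U | IsRightIdeal A}.Finite ↔ (Set.range (principalRight : U → Set U)).Finite := by
  constructor
  · intro hf
    refine hf.subset ?_
    rintro _ ⟨x, rfl⟩
    refine ⟨⟨x, h.mem_principalRight x⟩, ?_⟩
    rintro s _ ⟨z, rfl⟩
    exact ⟨z * s, (mul_assoc _ _ _).symm⟩
  · intro hf
    refine (hf.finite_subsets.image Set.sUnion).subset fun A hA => ?_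
    refine ⟨principalRight '' A, Set.image_subset_range _ _, ?_⟩
    ext x
    constructor
    · rintro ⟨_, ⟨a, ha, rfl⟩, z, rfl⟩
      exact hA.2 z a ha
    · exact fun hx => ⟨_, ⟨x, hx, rfl⟩, h.mem_principalRight x⟩

theorem finite_range_principalLeft_op
    (h : (Set.range (principalRight : U → Set U)).Finite) :
    (Set.range (principalLeft : Uᵐᵒᵖ → Set Uᵐᵒᵖ)).Finite := by
  refine (h.image (Set.preimage MulOpposite.unop)).subset ?_
  rintro _ ⟨x, rfl⟩
  refine ⟨_, ⟨x.unop, rfl⟩, Set.ext fun y => ?_⟩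
  exact ⟨fun ⟨z, hz⟩ => ⟨MulOpposite.op z, MulOpposite.unop_injective hz⟩,
    fun ⟨z, hz⟩ => ⟨z.unop, congrArg MulOpposite.unop hz⟩⟩

theorem finite_range_principalRight_op
    (h : (Set.range (principalLeft : U → Set U)).Finite) :
    (Set.range (principalRight : Uᵐᵒᵖ → Set Uᵐᵒᵖ)).Finite := by
  refine (h.image (Set.preimage MulOpposite.unop)).subset ?_
  rintro _ ⟨x, rfl⟩
  refine ⟨_, ⟨x.unop, rfl⟩, Set.ext fun y => ?_⟩
  exact ⟨fun ⟨z, hz⟩ => ⟨MulOpposite.op z, MulOpposite.unop_injective hz⟩,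
    fun ⟨z, hz⟩ => ⟨z.unop, congrArg MulOpposite.unop hz⟩⟩

theorem finite_range_principalLeft_of_op
    (h : (Set.range (principalRight : Uᵐᵒᵖ → Set Uᵐᵒᵖ)).Finite) :
    (Set.range (principalLeft : U → Set U)).Finite := by
  refine (h.image (Set.preimage MulOpposite.op)).subset ?_
  rintro _ ⟨x, rfl⟩
  refine ⟨_, ⟨MulOpposite.op x, rfl⟩, Set.ext fun y => ?_⟩
  exact ⟨fun ⟨z, hz⟩ => ⟨z.unop, congrArg MulOpposite.unop hz⟩,
    fun ⟨z, hz⟩ => ⟨MulOpposite.op z, MulOpposite.unop_injective hz⟩⟩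

theorem RecoversFactors.exists_idempotent (h : RecoversFactors U) (x : U) :
    ∃ e : U, IsIdempotentElem e := by
  obtain ⟨z, hz⟩ := h.right x x
  obtain ⟨w, hw⟩ := h.left x x
  -- Both `x * z` and `w * x` equal `w * x * x * z`.
  have hwz : w * x = x * z := by
    conv_lhs => rw [← hz]
    conv_rhs => rw [← hw]
    simp only [mul_assoc]
  refine ⟨x * z, ?_⟩
  rw [IsIdempotentElem, ← mul_assoc, ← hwz, mul_assoc w, hw, hwz]

/-- Some element acts as a right identity on the principal left ideal of `x`. -/
theorem RecoversFactors.exists_right_identity (h : RecoversFactors U) (x : U) :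
    ∃ f, ∀ y ∈ principalLeft x, y * f = y := by
  obtain ⟨z, hz⟩ := h.right x x
  refine ⟨x * z, ?_⟩
  rintro _ ⟨y, rfl⟩
  rw [mul_assoc, ← mul_assoc x, hz]

/-- The group `G` is embedded in `U` as the local submonoid `eUe`, where `e` is the image
of `1`. -/
structure IsLocalGroup {G : Type u} [Group G] (ι : G →ₙ* U) : Prop where
  injective : Injective ι
  exists_eq : ∀ x, ∃ g, ι g = ι 1 * x * ι 1

namespace IsLocalGroup

variable {G : Type u} [Group G] {ι : G →ₙ* U}

theorem one_mul_map (ι : G →ₙ* U) (g : G) : ι 1 * ι g = ι g := by rw [← map_mul, one_mul]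

theorem map_mul_one (ι : G →ₙ* U) (g : G) : ι g * ι 1 = ι g := by rw [← map_mul, mul_one]

/-- The opposite semigroup has the same local groups, embedded by means of the inverse. -/
theorem op (hι : IsLocalGroup ι) : IsLocalGroup
    ({ toFun := fun g => MulOpposite.op (ι g⁻¹)
       map_mul' := fun g h => by rw [mul_inv_rev, map_mul, MulOpposite.op_mul] } : G →ₙ* Uᵐᵒᵖ) where
  injective g h hgh := inv_injective (hι.injective (MulOpposite.op_injective hgh))
  exists_eq x := by
    obtain ⟨g, hg⟩ := hι.exists_eq x.unop
    refine ⟨g⁻¹, MulOpposite.unop_injective ?_⟩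
    simp [hg, mul_assoc]

/-- A transversal of the principal right ideals in the left ideal `Ue`. -/
theorem exists_transversal (h : RecoversFactors U) (hι : IsLocalGroup ι) :
    ∃ r : Set.range (principalRight : U → Set U) → U,
      (∀ i, r i * ι 1 = r i) ∧ (∀ i, principalRight (r i) = i) ∧
      (∀ i g k l, r i * ι g = r k * ι l → i = k ∧ g = l) ∧
      ∀ x, x * ι 1 = x → ∃ i g, x = r i * ι g := by
  obtain ⟨r, hr1, hr2⟩ : ∃ r : Set.range (principalRight : U → Set U) → U,
      (∀ i, r i * ι 1 = r i) ∧ ∀ i, principalRight (r i) = i :=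
    ⟨fun i => i.2.choose * ι 1, fun i => by rw [mul_assoc, map_mul_one], fun i => by
      rw [h.principalRight_mul, i.2.choose_spec]⟩
  refine ⟨r, hr1, hr2, fun i g k l hik => ?_, fun x hx => ?_⟩
  · have : i = k := by
      apply Subtype.ext
      rw [← hr2, ← h.principalRight_mul _ (ι g), hik, h.principalRight_mul, hr2]
    subst this
    refine ⟨rfl, hι.injective ?_⟩
    obtain ⟨z, hz⟩ := h.left (ι 1) (r i)
    rw [hr1] at hz
    rw [← one_mul_map ι g, ← one_mul_map ι l, ← hz, mul_assoc, mul_assoc, hik]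
  · obtain ⟨z, hz⟩ : x ∈ principalRight (r ⟨_, x, rfl⟩) := by
      rw [hr2]
      exact h.mem_principalRight x
    obtain ⟨g, hg⟩ := hι.exists_eq z
    refine ⟨⟨_, x, rfl⟩, g, ?_⟩
    rw [hg, ← mul_assoc, ← mul_assoc, hr1, hz, hx]

/-- A transversal of the principal left ideals in the right ideal `eU`. -/
theorem exists_transversal_left (h : RecoversFactors U) (hι : IsLocalGroup ι) :
    ∃ t : Set.range (principalLeft : U → Set U) → U,
      (∀ l, ι 1 * t l = t l) ∧
      (∀ l g m k, ι g * t l = ι k * t m → l = m ∧ g = k) ∧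
      ∀ x, ι 1 * x = x → ∃ l g, x = ι g * t l := by
  obtain ⟨t, ht1, ht2⟩ : ∃ t : Set.range (principalLeft : U → Set U) → U,
      (∀ l, ι 1 * t l = t l) ∧ ∀ l, principalLeft (t l) = l :=
    ⟨fun l => ι 1 * l.2.choose, fun l => by rw [← mul_assoc, one_mul_map], fun l => by
      rw [h.principalLeft_mul, l.2.choose_spec]⟩
  refine ⟨t, ht1, fun l g m k hlm => ?_, fun x hx => ?_⟩
  · have : l = m := by
      apply Subtype.ext
      rw [← ht2, ← h.principalLeft_mul (ι g), hlm, h.principalLeft_mul, ht2]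
    subst this
    refine ⟨rfl, hι.injective ?_⟩
    obtain ⟨z, hz⟩ := h.right (ι 1) (t l)
    rw [ht1] at hz
    rw [← map_mul_one ι g, ← map_mul_one ι k, ← hz, ← mul_assoc, ← mul_assoc, hlm]
  · obtain ⟨z, hz⟩ : x ∈ principalLeft (t ⟨_, x, rfl⟩) := by
      rw [ht2]
      exact h.mem_principalLeft x
    obtain ⟨g, hg⟩ := hι.exists_eq z
    refine ⟨⟨_, x, rfl⟩, g, ?_⟩
    rw [hg, mul_assoc, ht1, mul_assoc, hz, hx]

end IsLocalGroup

end Semigroup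

/-! ### The monoid obtained by adjoining an identity -/

section WithOne

variable {U : Type u} [Semigroup U]

/-- Adjoining an identity commutes with passing to the opposite. -/
def withOneOpEquiv (U : Type u) [Semigroup U] : WithOne Uᵐᵒᵖ ≃* (WithOne U)ᵐᵒᵖ where
  toFun := WithOne.lift
    { toFun := fun x => MulOpposite.op (x.unop : WithOne U)
      map_mul' := fun _ _ => rfl }
  invFun x := WithOne.recOneCoe 1 (fun u => (MulOpposite.op u : WithOne Uᵐᵒᵖ)) x.unop
  left_inv x := by
    cases x <;> rfl
  right_inv x := by
    induction x using MulOpposite.rec' with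
    | h x => cases x <;> rfl
  map_mul' := map_mul _

/-- The ring homomorphism `ℤU¹ → ℤ` that kills `U`. -/
def killU (U : Type u) [Semigroup U] : MonoidAlgebra ℤ (WithOne U) →+* ℤ :=
  (MonoidAlgebra.lift ℤ ℤ (WithOne U)
    (WithOne.lift { toFun := fun _ => 0, map_mul' := fun _ _ => (mul_zero _).symm }) :
      MonoidAlgebra ℤ (WithOne U) →+* ℤ)

theorem killU_single_coe (u : U) (k : ℤ) :
    killU U (MonoidAlgebra.single (u : WithOne U) k) = 0 := by
  simp [killU]

theorem killU_single_one (k : ℤ) :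
    killU U (MonoidAlgebra.single (1 : WithOne U) k) = k := by
  simp [killU]

/-- The left action of `U¹` on `U`. -/
def leftMulCocycle (U : Type u) [Semigroup U] : Cocycle (WithOne U) PUnit U where
  act m x := WithOne.recOneCoe x (fun u => u * x) m
  coc _ _ := 1
  act_one _ := rfl
  act_mul p q x := by
    cases p with
    | one => rw [one_mul]; rfl
    | coe a =>
      cases q with
      | one => rw [mul_one]; rfl
      | coe b => exact mul_assoc a b x
  coc_one _ := rfl
  coc_mul _ _ _ := rfl

theorem coe_leftMulCocycle_act (m : WithOne U) (x : U) :
    ((leftMulCocycle U).act m x : WithOne U) = m * x := by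
  cases m with
  | one => exact (one_mul _).symm
  | coe a => rfl

/-- If `U` has finitely many left ideals then `ℤU` is the direct sum of the ideals generated by
finitely many idempotents of `ℤU¹`, and `ℤ` with `U` acting as zero is its cokernel in `ℤU¹`. -/
theorem fp_triv_killU (h : RecoversFactors U)
    (hf : (Set.range (principalLeft : U → Set U)).Finite) (n : ℕ) :
    FP (MonoidAlgebra ℤ (WithOne U)) n (Triv (killU U)) := by
  have : Finite (Set.range (principalLeft : U → Set U)) := hf
  have hid : ∀ l : Set.range (principalLeft : U → Set U), ∃ f, ∀ y ∈ l.1, y * f = y := by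
    rintro ⟨_, x, rfl⟩
    exact h.exists_right_identity x
  choose f hf' using hid
  let κ := leftMulCocycle U
  have hfp : FP (MonoidAlgebra ℤ (WithOne U)) n (κ.Ind (MonoidAlgebra ℤ PUnit)) := by
    refine κ.fp_ind_regular (fun u _ => ⟨principalLeft u, u, rfl⟩) (fun u _ => (u : WithOne U))
      (fun l => (f l, 1)) (fun m u _ => ?_) (fun m u _ => ?_) (fun u _ => ?_) (fun _ _ => rfl) n
    · cases m with
      | one => rfl
      | coe a => exact Subtype.ext (h.principalLeft_mul a u)
    · exact coe_leftMulCocycle_act m u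
    · exact hf' _ u (h.mem_principalLeft u)
  let i : κ.Ind (MonoidAlgebra ℤ PUnit) →ₗ[MonoidAlgebra ℤ (WithOne U)]
      MonoidAlgebra ℤ (WithOne U) :=
    κ.liftLinear (fun u => liftAdd fun _ => MonoidAlgebra.single (u : WithOne U) (1 : ℤ))
      fun m u a => by
        induction a using MonoidAlgebra.induction_linear with
        | zero => simp
        | add a b ha hb => simp only [smul_add, map_add, ha, hb]
        | single g k =>
          rw [smul_eq_mul, MonoidAlgebra.single_mul_single, liftAdd_single, liftAdd_single,
            coe_leftMulCocycle_act, smul_eq_mul, mul_smul_comm, MonoidAlgebra.single_mul_single,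
            one_mul, one_mul]
  have hi : ∀ u k, i (κ.single u (MonoidAlgebra.single PUnit.unit k)) =
      MonoidAlgebra.single (u : WithOne U) k := fun u k => by
    rw [Cocycle.liftLinear_single, liftAdd_single]
    simp
  let p : MonoidAlgebra ℤ (WithOne U) →+ κ.Ind (MonoidAlgebra ℤ PUnit) :=
    liftAdd fun m => WithOne.recOneCoe 0
      (fun u => κ.single u (MonoidAlgebra.single PUnit.unit (1 : ℤ))) m
  have hpi : p.comp i.toAddMonoidHom = AddMonoidHom.id _ := κ.addHom_ext fun u a => by
    induction a using MonoidAlgebra.induction_linear with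
    | zero => simp
    | add a b ha hb => rw [map_add, map_add, map_add, ha, hb]
    | single g k =>
      refine (congrArg p (hi u k)).trans ?_
      rw [liftAdd_single, WithOne.recOneCoe_coe, ← map_zsmul]
      simp
  let π : MonoidAlgebra ℤ (WithOne U) →ₗ[MonoidAlgebra ℤ (WithOne U)] Triv (killU U) :=
    LinearMap.toSpanSingleton _ _ ((Triv.toInt _).symm 1)
  have hπ : ∀ x, Triv.toInt _ (π x) = killU U x := fun x => by
    rw [LinearMap.toSpanSingleton_apply, Triv.toInt_smul, AddEquiv.apply_symm_apply, mul_one]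
  have hdecomp : ∀ x, x = i (p x) + killU U x • 1 := fun x => by
    induction x using MonoidAlgebra.induction_linear with
    | zero => simp
    | add x y hx hy =>
      conv_lhs => rw [hx, hy]
      simp only [map_add, add_smul]
      abel
    | single m k =>
      rw [liftAdd_single, map_zsmul]
      cases m with
      | one =>
        rw [killU_single_one, WithOne.recOneCoe_one, map_zero, smul_zero, zero_add]
        simp [MonoidAlgebra.one_def]
      | coe u =>
        rw [killU_single_coe, WithOne.recOneCoe_coe, hi]
        simp
  refine (FP.quotient (f := i) (g := π) ?_ (fun x => ⟨fun hx => ?_, ?_⟩) (fun z => ?_) hfp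
    (FP.of_projective (n + 1))).pred
  · exact LeftInverse.injective (g := p) (DFunLike.congr_fun hpi)
  · refine ⟨p x, ?_⟩
    conv_rhs => rw [hdecomp x]
    rw [← hπ, hx, map_zero, zero_smul, add_zero]
  · rintro ⟨v, rfl⟩
    have : (Triv.toInt (killU U)).toAddMonoidHom.comp
        (π.toAddMonoidHom.comp i.toAddMonoidHom) = 0 := κ.addHom_ext fun u a => by
      induction a using MonoidAlgebra.induction_linear with
      | zero => simp
      | add a b ha hb => rw [map_add, map_add, ha, hb, map_add]
      | single g k =>
        refine (hπ _).trans ?_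
        refine (congrArg (killU U) (hi u k)).trans ?_
        exact killU_single_coe u k
    exact (Triv.toInt _).injective ((DFunLike.congr_fun this v).trans (map_zero _).symm)
  · refine ⟨MonoidAlgebra.single 1 (Triv.toInt _ z), (Triv.toInt _).injective ?_⟩
    rw [hπ, killU_single_one]

end WithOne

/-! ### Finiteness properties of completely simple semigroups -/

section CompletelySimple

variable {U : Type u} [Semigroup U]

/-- A `ℤU¹`-module that is killed by `U` is a direct sum of copies of `ℤ` as soon as it is so as an
abelian group. -/
theorem fp_of_killed (h : RecoversFactors U)
    (hf : (Set.range (principalLeft : U → Set U)).Finite) (n : ℕ) {K : Type u} [AddCommGroup K]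
    [Module (MonoidAlgebra ℤ (WithOne U)) K] [Module.Finite ℤ K] [Module.Free ℤ K]
    (hK : ∀ (u : U) (x : K),
      (MonoidAlgebra.single (u : WithOne U) 1 : MonoidAlgebra ℤ (WithOne U)) • x = 0) :
    FP (MonoidAlgebra ℤ (WithOne U)) n K := by
  let b := Module.finBasis ℤ K
  let e : K ≃+ (Fin (Module.finrank ℤ K) → Triv (killU U)) :=
    b.equivFun.toAddEquiv.trans (AddEquiv.piCongrRight fun _ => (Triv.toInt (killU U)).symm)
  let f := linearOfComm (M := WithOne U) e.toAddMonoidHom fun m x => by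
    cases m with
    | one =>
      rw [← MonoidAlgebra.one_def, one_smul, one_smul]
    | coe u =>
      rw [hK, map_zero]
      ext j
      apply (Triv.toInt _).injective
      rw [Pi.smul_apply, Triv.toInt_smul, killU_single_coe, zero_mul]
      exact map_zero _
  exact FP.equiv (LinearEquiv.ofBijective f e.bijective).symm ((fp_triv_killU h hf n).pi _)

theorem MonoidIsLeftFP.withOne (h : RecoversFactors U)
    (hR : (Set.range (principalRight : U → Set U)).Finite)
    (hL : (Set.range (principalLeft : U → Set U)).Finite) {G : Type u} [Group G] {ι : G →ₙ* U}
    (hι : IsLocalGroup ι) {n : ℕ} (hG : MonoidIsLeftFP n G) : MonoidIsLeftFP n (WithOne U) := by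
  have : Finite (Set.range (principalRight : U → Set U)) := hR
  rw [MonoidIsLeftFP, trivialModuleIsFP_iff] at hG ⊢
  obtain ⟨r, hr1, hr2, huniq, hex⟩ := hι.exists_transversal h
  obtain ⟨i₀, g₀, h₀⟩ := hex (ι 1) (IsLocalGroup.map_mul_one ι 1)
  let ι' : G →ₙ* WithOne U := WithOne.coeMulHom.comp ι
  let r' : Set.range (principalRight : U → Set U) → WithOne U := fun i => r i
  have hr1' : ∀ i, r' i * ι' 1 = r' i := fun i => congrArg WithOne.coe (hr1 i)
  have huniq' : ∀ i g k l, r' i * ι' g = r' k * ι' l → i = k ∧ g = l := fun i g k l hik =>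
    huniq i g k l (WithOne.coe_injective hik)
  have hex' : ∀ q i, ∃ p : Set.range (principalRight : U → Set U) × G,
      q * r' i = r' p.1 * ι' p.2 := fun q i => by
    cases q with
    | one => exact ⟨(i, 1), by rw [one_mul, hr1']⟩
    | coe u =>
      obtain ⟨k, g, hk⟩ := hex (u * r i) (by rw [mul_assoc, hr1])
      exact ⟨(k, g), congrArg WithOne.coe hk⟩
  let κ := Cocycle.ofTransversal ι' r' hr1' huniq' hex'
  have hind : FP (MonoidAlgebra ℤ (WithOne U)) n
      (κ.Ind (Triv (augmentation G : MonoidAlgebra ℤ G →+* ℤ))) :=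
    Cocycle.fp_ind_ofTransversal ι' r' hr1' huniq' hex' ⟨(i₀, g₀), congrArg WithOne.coe h₀⟩ hG
  -- An element of `U` maps all summands of the induced module to a single one.
  have hact : ∀ (u : U) i, κ.act u i = ⟨principalRight u, u, rfl⟩ := fun u i => by
    have h1 : u * r i = r (κ.act u i) * ι (κ.coc u i) := WithOne.coe_injective
      (Cocycle.ofTransversal_spec ι' r' hr1' huniq' hex' u i)
    apply Subtype.ext
    rw [← hr2, ← h.principalRight_mul _ (ι (κ.coc u i)), ← h1, h.principalRight_mul]
  let c : Triv (augmentation G : MonoidAlgebra ℤ G →+* ℤ) ≃+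
      Triv (augmentation (WithOne U) : MonoidAlgebra ℤ (WithOne U) →+* ℤ) :=
    (Triv.toInt _).trans (Triv.toInt _).symm
  let f : κ.Ind (Triv (augmentation G : MonoidAlgebra ℤ G →+* ℤ))
      →ₗ[MonoidAlgebra ℤ (WithOne U)]
      Triv (augmentation (WithOne U) : MonoidAlgebra ℤ (WithOne U) →+* ℤ) :=
    κ.liftLinear (fun _ => c.toAddMonoidHom) fun q i a => by
      rw [single_smul_triv, single_smul_triv, one_smul, one_smul]
  have hsmul : ∀ (u : U) v, (MonoidAlgebra.single (u : WithOne U) 1 :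
      MonoidAlgebra ℤ (WithOne U)) • v =
        κ.single ⟨principalRight u, u, rfl⟩ (c.symm (f v)) := fun u v => by
    have : DistribSMul.toAddMonoidHom _ (MonoidAlgebra.single (u : WithOne U) 1 :
        MonoidAlgebra ℤ (WithOne U)) = (κ.single ⟨principalRight u, u, rfl⟩).comp
          (c.symm.toAddMonoidHom.comp f.toAddMonoidHom) := κ.addHom_ext fun i a => by
      have h1 : c.symm (f (κ.single i a)) = a :=
        (congrArg c.symm (κ.liftLinear_single _ _ i a)).trans (c.symm_apply_apply a)
      refine (κ.smul_single _ i a).trans ?_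
      rw [hact, single_smul_triv, one_smul]
      exact congrArg _ h1.symm
    exact DFunLike.congr_fun this v
  have hfs : Surjective f := fun z =>
    ⟨κ.single i₀ (c.symm z), (κ.liftLinear_single _ _ _ _).trans (c.apply_symm_apply z)⟩
  let coords : LinearMap.ker f →+ (Set.range (principalRight : U → Set U) → ℤ) :=
    { toFun := fun x i => Triv.toInt _ ((κ.rep _).asModuleEquiv x.1 i)
      map_zero' := by ext i; simp
      map_add' := fun x y => by ext i; simp }
  have hinj : Injective coords.toIntLinearMap := fun x y hxy => by
    apply Subtype.ext
    apply (κ.rep _).asModuleEquiv.injective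
    ext i
    exact (Triv.toInt _).injective (congrFun hxy i)
  have : Module.Finite ℤ (LinearMap.ker f) := Module.Finite.of_injective _ hinj
  have : Module.IsTorsionFree ℤ (LinearMap.ker f) :=
    hinj.moduleIsTorsionFree _ fun k x => map_smul coords.toIntLinearMap k x
  have hK : FP (MonoidAlgebra ℤ (WithOne U)) n (LinearMap.ker f) :=
    fp_of_killed h hL n fun u x => Subtype.ext (by
      refine (hsmul u x.1).trans ?_
      rw [LinearMap.mem_ker.1 x.2, map_zero, map_zero]
      rfl)
  cases n with
  | zero =>
    have := hind.finite
    exact Module.Finite.of_surjective f hfs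
  | succ n =>
    exact FP.quotient (Submodule.subtype_injective _) (LinearMap.exact_subtype_ker_map f) hfs
      hK.pred hind

/-- If `U¹` is of type left-`FP_1`, then its augmentation ideal is finitely generated.  Summing
coefficients over each principal right ideal maps it onto a free abelian group, on which `U` acts as
zero; so the rank of this group is finite. -/
theorem finite_principalRight_of_leftFP (h : RecoversFactors U)
    (hU : MonoidIsLeftFP 1 (WithOne U)) :
    (Set.range (principalRight : U → Set U)).Finite := by
  rw [MonoidIsLeftFP, trivialModuleIsFP_iff] at hU
  let ε : MonoidAlgebra ℤ (WithOne U) →+* ℤ := augmentation (WithOne U)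
  have hε : ∀ m k, ε (MonoidAlgebra.single m k) = k := augmentation_single _
  let π : MonoidAlgebra ℤ (WithOne U) →ₗ[MonoidAlgebra ℤ (WithOne U)] Triv ε :=
    LinearMap.toSpanSingleton _ _ ((Triv.toInt _).symm 1)
  have hπ : ∀ x, Triv.toInt _ (π x) = ε x := fun x => by
    rw [LinearMap.toSpanSingleton_apply, Triv.toInt_smul, AddEquiv.apply_symm_apply, mul_one]
  have hπs : Surjective π := fun z => ⟨MonoidAlgebra.single 1 (Triv.toInt _ z),
    (Triv.toInt _).injective (by rw [hπ, hε])⟩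
  have hfin : Module.Finite (MonoidAlgebra ℤ (WithOne U)) (LinearMap.ker π) :=
    (FP.ker_of_surjective (n := 0) π hπs hU).finite
  let I := Set.range (principalRight : U → Set U)
  let cls : U → I := fun u => ⟨principalRight u, u, rfl⟩
  let φ : MonoidAlgebra ℤ (WithOne U) →+ (I →₀ ℤ) :=
    liftAdd fun m => WithOne.recOneCoe 0 (fun u => Finsupp.single (cls u) 1) m
  have hφ1 : ∀ k, φ (MonoidAlgebra.single 1 k) = 0 := fun k => by
    rw [liftAdd_single, WithOne.recOneCoe_one, smul_zero]
  have hφc : ∀ (u : U) k, φ (MonoidAlgebra.single (u : WithOne U) k) =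
      Finsupp.single (cls u) k := fun u k => by
    rw [liftAdd_single, WithOne.recOneCoe_coe]
    simp
  have hφu : ∀ (u : U) k y, φ (MonoidAlgebra.single (u : WithOne U) k * y) =
      Finsupp.single (cls u) (k * ε y) := fun u k y => by
    induction y using MonoidAlgebra.induction_linear with
    | zero => simp
    | add x y hx hy => rw [mul_add, map_add, hx, hy, map_add, mul_add, Finsupp.single_add]
    | single m l =>
      rw [MonoidAlgebra.single_mul_single, hε]
      cases m with
      | one => rw [mul_one, hφc]
      | coe v =>
        rw [← WithOne.coe_mul, hφc]
        congr 1
        exact Subtype.ext (h.principalRight_mul u v)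
  have hsmul : ∀ x y, ε y = 0 → φ (x * y) = killU U x • φ y := fun x y hy => by
    induction x using MonoidAlgebra.induction_linear with
    | zero => simp
    | add a b ha hb => rw [add_mul, map_add, ha, hb, map_add, add_smul]
    | single m k =>
      cases m with
      | one =>
        rw [killU_single_one, ← map_zsmul]
        congr 1
        have : (MonoidAlgebra.single 1 k : MonoidAlgebra ℤ (WithOne U)) = k • 1 := by
          simp [MonoidAlgebra.one_def]
        rw [this, smul_mul_assoc, one_mul]
      | coe u => rw [hφu, hy, killU_single_coe, mul_zero, Finsupp.single_zero, zero_smul]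
  have hker : ∀ y ∈ LinearMap.ker π, ε y = 0 := fun y hy => by
    rw [← hπ, LinearMap.mem_ker.1 hy, map_zero]
  let ψ : LinearMap.ker π →ₛₗ[killU U] (I →₀ ℤ) :=
    { toFun := fun y => φ y.1
      map_add' := fun x y => map_add φ _ _
      map_smul' := fun x y => hsmul x y.1 (hker _ y.2) }
  have : RingHomSurjective (killU U) := ⟨fun k => ⟨_, killU_single_one k⟩⟩
  have hψ : Surjective ψ := fun v => by
    induction v using Finsupp.induction_linear with
    | zero => exact ⟨0, map_zero ψ⟩
    | add v w hv hw =>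
      obtain ⟨x, rfl⟩ := hv
      obtain ⟨y, rfl⟩ := hw
      exact ⟨x + y, map_add ψ x y⟩
    | single i k =>
      obtain ⟨_, u, rfl⟩ := i
      refine ⟨⟨MonoidAlgebra.single (u : WithOne U) k - MonoidAlgebra.single 1 k, ?_⟩, ?_⟩
      · rw [LinearMap.mem_ker]
        apply (Triv.toInt _).injective
        rw [hπ, map_sub, hε, hε, sub_self, map_zero]
      · change φ (_ - _) = _
        rw [map_sub, hφ1, hφc, sub_zero]
  have : Module.Finite ℤ (I →₀ ℤ) := Module.Finite.of_surjective ψ hψ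
  exact Module.Finite.finite_basis (Finsupp.basisSingleOne (R := ℤ) (ι := I))

theorem MonoidIsLeftFP.of_withOne (h : RecoversFactors U)
    (hL : (Set.range (principalLeft : U → Set U)).Finite) {G : Type u} [Group G] {ι : G →ₙ* U}
    (hι : IsLocalGroup ι) {n : ℕ} (hU : MonoidIsLeftFP n (WithOne U)) : MonoidIsLeftFP n G := by
  have : Finite (Set.range (principalLeft : U → Set U)) := hL
  obtain ⟨t, ht, huniq, hex⟩ := hι.exists_transversal_left h
  refine hU.corner (WithOne.coeMulHom.comp ι) (fun l => (t l : WithOne U))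
    (fun l => congrArg WithOne.coe (ht l))
    (fun l g m k hlm => huniq l g m k (WithOne.coe_injective hlm)) fun q => ?_
  cases q with
  | one =>
    obtain ⟨l, g, hg⟩ := hex (ι 1) (IsLocalGroup.one_mul_map ι 1)
    exact ⟨(l, g), (mul_one _).trans (congrArg WithOne.coe hg)⟩
  | coe u =>
    obtain ⟨l, g, hg⟩ := hex (ι 1 * u) (by rw [← mul_assoc, IsLocalGroup.one_mul_map])
    exact ⟨(l, g), congrArg WithOne.coe hg⟩

theorem monoidIsRightFP_withOne_iff {n : ℕ} :
    MonoidIsRightFP n (WithOne U) ↔ MonoidIsLeftFP n (WithOne Uᵐᵒᵖ) :=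
  monoidIsRightFP_iff.trans ⟨MonoidIsLeftFP.of_mulEquiv (withOneOpEquiv U).symm,
    MonoidIsLeftFP.of_mulEquiv (withOneOpEquiv U)⟩

/-- The characterization for the monoid `U¹`. -/
theorem leftFP_and_rightFP_withOne_iff (h : RecoversFactors U) {G : Type u} [Group G]
    {ι : G →ₙ* U} (hι : IsLocalGroup ι) {n : ℕ} (hn : 1 ≤ n) :
    (MonoidIsLeftFP n (WithOne U) ∧ MonoidIsRightFP n (WithOne U)) ↔
      HasFinitelyManyLeftAndRightIdeals U ∧ GroupIsFP n G := by
  rw [HasFinitelyManyLeftAndRightIdeals, h.finite_leftIdeals_iff, h.finite_rightIdeals_iff,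
    monoidIsRightFP_withOne_iff]
  have mono : ∀ {V : Type u} [Semigroup V], MonoidIsLeftFP n (WithOne V) →
      MonoidIsLeftFP 1 (WithOne V) := fun hV => by
    rw [MonoidIsLeftFP, trivialModuleIsFP_iff] at hV ⊢
    exact hV.mono hn
  constructor
  · rintro ⟨h1, h2⟩
    have hL := finite_range_principalLeft_of_op (finite_principalRight_of_leftFP h.op (mono h2))
    exact ⟨⟨hL, finite_principalRight_of_leftFP h (mono h1)⟩, h1.of_withOne h hL hι⟩
  · rintro ⟨⟨hL, hR⟩, hG⟩
    exact ⟨MonoidIsLeftFP.withOne h hR hL hι hG, MonoidIsLeftFP.withOne h.op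
      (finite_range_principalRight_op hL) (finite_range_principalLeft_op hR) hι.op hG⟩

/-- The embedding of a maximal subgroup. -/
def MaximalSubgroup.hom {e : U} (he : IsIdempotentElem e) : MaximalSubgroup he →ₙ* U :=
  letI := cornerMonoid he
  { toFun := fun g => ((show (Subsemigroup.corner e)ˣ from g).val : U)
    map_mul' := fun _ _ => rfl }

theorem MaximalSubgroup.hom_one {e : U} (he : IsIdempotentElem e) :
    MaximalSubgroup.hom he 1 = e := rfl

/-- In a completely simple semigroup every element of `eUe` is invertible. -/
theorem isLocalGroup_hom (h : RecoversFactors U) {e : U} (he : IsIdempotentElem e) :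
    IsLocalGroup (MaximalSubgroup.hom he) where
  injective x y hxy := by
    let := cornerMonoid he
    exact Units.ext (Subtype.ext hxy)
  exists_eq x := by
    let := cornerMonoid he
    rw [MaximalSubgroup.hom_one]
    obtain ⟨z, hz⟩ := h.right e (x * e)
    obtain ⟨w, hw⟩ := h.left e (e * x)
    have hee : e * e = e := he
    let a : Subsemigroup.corner e := ⟨e * x * e, x, rfl⟩
    let b : Subsemigroup.corner e := ⟨e * z * e, z, rfl⟩
    let c : Subsemigroup.corner e := ⟨e * w * e, w, rfl⟩
    have hab : a * b = 1 := Subtype.ext (by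
      change e * x * e * (e * z * e) = e
      calc e * x * e * (e * z * e) = e * (x * (e * e)) * z * e := by simp only [mul_assoc]
        _ = e := by rw [hee, hz, hee])
    have hca : c * a = 1 := Subtype.ext (by
      change e * w * e * (e * x * e) = e
      calc e * w * e * (e * x * e) = e * (w * (e * e * x * e)) := by simp only [mul_assoc]
        _ = e := by rw [hee, hw, hee])
    have hcb : c = b := left_inv_eq_right_inv hca hab
    exact ⟨(⟨a, b, hab, hcb ▸ hca⟩ : (Subsemigroup.corner e)ˣ), rfl⟩

/-- The characterization for a semigroup `U` with an identity, which is then a group. -/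
theorem leftFP_and_rightFP_of_identity_iff (h : RecoversFactors U) {o : U} (ho : IsIdentity o)
    {G : Type u} [Group G] {ι : G →ₙ* U} (hι : IsLocalGroup ι) {n : ℕ} :
    letI := monoidOfIdentity o ho
    (MonoidIsLeftFP n U ∧ MonoidIsRightFP n U) ↔
      HasFinitelyManyLeftAndRightIdeals U ∧ GroupIsFP n G := by
  let := monoidOfIdentity o ho
  have hone : ι 1 = 1 := by
    obtain ⟨z, hz⟩ := h.left 1 (ι 1)
    rw [mul_one] at hz
    calc ι 1 = z * ι 1 * ι 1 := by rw [hz, one_mul]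
      _ = 1 := by rw [mul_assoc, ← map_mul, one_mul, hz]
  let e : G ≃* U := MulEquiv.ofBijective ι ⟨hι.injective, fun x => by
    obtain ⟨g, hg⟩ := hι.exists_eq x
    exact ⟨g, by rw [hg, hone, one_mul, mul_one]⟩⟩
  have hfin : HasFinitelyManyLeftAndRightIdeals U := by
    rw [HasFinitelyManyLeftAndRightIdeals, h.finite_leftIdeals_iff, h.finite_rightIdeals_iff]
    constructor
    · refine (Set.finite_singleton (principalLeft (1 : U))).subset ?_
      rintro _ ⟨x, rfl⟩
      rw [Set.mem_singleton_iff, ← h.principalLeft_mul (e (e.symm x)⁻¹) x]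
      congr 1
      conv_lhs => rw [← e.apply_symm_apply x, ← map_mul]
      simp
    · refine (Set.finite_singleton (principalRight (1 : U))).subset ?_
      rintro _ ⟨x, rfl⟩
      rw [Set.mem_singleton_iff, ← h.principalRight_mul x (e (e.symm x)⁻¹)]
      congr 1
      conv_lhs => rw [← e.apply_symm_apply x, ← map_mul]
      simp
  rw [monoidIsRightFP_iff]
  constructor
  · exact fun hU => ⟨hfin, hU.1.of_mulEquiv e.symm⟩
  · exact fun hG => ⟨MonoidIsLeftFP.of_mulEquiv e hG.2,
      MonoidIsLeftFP.of_mulEquiv ((MulEquiv.inv' G).trans e.op) hG.2⟩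

theorem isLeftFP_and_isRightFP_iff (h : RecoversFactors U) {n : ℕ} (hn : 1 ≤ n) {e : U}
    (he : IsIdempotentElem e) :
    (IsLeftFP n U ∧ IsRightFP n U) ↔
      HasFinitelyManyLeftAndRightIdeals U ∧ GroupIsFP n (MaximalSubgroup he) := by
  have hι := isLocalGroup_hom h he
  unfold IsLeftFP IsRightFP ExtendToSemigroup
  split_ifs with ho
  · exact leftFP_and_rightFP_of_identity_iff h ho.choose_spec hι
  · exact leftFP_and_rightFP_withOne_iff h hι hn

theorem isBiFP_iff {n : ℕ} : IsBiFP n U ↔ IsLeftFP n U ∧ IsRightFP n U := by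
  unfold IsBiFP IsLeftFP IsRightFP ExtendToSemigroup
  split_ifs with ho
  · exact @monoidIsBiFP_iff U (monoidOfIdentity _ ho.choose_spec) n
  · exact monoidIsBiFP_iff

end CompletelySimple

end

end FPn

theorem mainTheorem1 {U : Type u} [Semigroup U] (hU : FPn.IsCompletelySimple U)
    (n : ℕ) (hn : 1 ≤ n) :
    (∀ (e : U) (he : IsIdempotentElem e),
      ((FPn.IsLeftFP n U ∧ FPn.IsRightFP n U) ↔
        (FPn.HasFinitelyManyLeftAndRightIdeals U ∧ FPn.GroupIsFP n (FPn.MaximalSubgroup he)))) ∧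
    (∀ (e : U) (he : IsIdempotentElem e),
      (FPn.IsBiFP n U ↔
        (FPn.HasFinitelyManyLeftAndRightIdeals U ∧ FPn.GroupIsFP n (FPn.MaximalSubgroup he)))) ∧
    (FPn.IsBiFP n U ↔
      (FPn.HasFinitelyManyLeftAndRightIdeals U ∧
        ∀ (e : U) (he : IsIdempotentElem e), FPn.GroupIsFP n (FPn.MaximalSubgroup he))) := by
  have h := hU.recoversFactors
  have key := fun (e : U) (he : IsIdempotentElem e) =>
    FPn.isLeftFP_and_isRightFP_iff h hn he
  refine ⟨key, fun e he => FPn.isBiFP_iff.trans (key e he), FPn.isBiFP_iff.trans ?_⟩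
  obtain ⟨x⟩ := hU.nonempty
  obtain ⟨e, he⟩ := h.exists_idempotent x
  exact ⟨fun hb => ⟨((key e he).1 hb).1, fun f hf => ((key f hf).1 hb).2⟩,
    fun hb => (key e he).2 ⟨hb.1, hb.2 e he⟩⟩
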